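/- Let $(R,\mathfrak m)$ be a Cohen–Macaulay (Noetherian) local ring of dimension $d$ with $1\le d\le 2$ and infinite residue field, and let $I,J$ be $\mathfrak m$-primary ideals of $R$. For an ideal $K$ put $K^n=R$ whenever $n\le 0$. Let $\mathcal F=\{\mathcal F(r,s)\}_{r,s\in\mathbb Z}$ be a $\mathbb Z^2$-graded $(I,J)$-admissible filtration of ideals of $R$; that is, for all integers $r,s,r',s'$: - $I^rJ^s\subseteq\mathcal F(r,s)$; - $\mathcal F(r,s)\,\mathcal F(r',s')\subseteq\mathcal F(r+r',s+s')$; - $\mathcal F(r',s')\subseteq\mathcal F(r,s)$ if $r'\ge r$ and $s'\ge s$; - $\mathcal F(r,s)=\mathcal F(\max(r,0),\max(s,0))$; and the extended Rees ring $\bigoplus_{r,s\in\mathbb Z}\mathcal F(r,s)t_1^rt_2^s$ is a finite module over $\bigoplus_{r,s\in\mathbb Z}I^rJ^st_1^rt_2^s$. Let $H_{\mathcal F}(r,s)=\lambda(R/\mathcal F(r,s))$, where $\lambda$ denotes length, and let $$P_{\mathcal F}(r,s)=\sum_{\alpha\in\mathbb N^2,\ |\alpha|\le d}(-1)^{d-|\alpha|}\,e_\alpha(\mathcal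 F)\binom{r+\alpha_1-1}{\alpha_1}\binom{s+\alpha_2-1}{\alpha_2},\qquad e_\alpha(\mathcal F)\in\mathbb Z,\quad |\alpha|=\alpha_1+\alpha_2,$$ be the Hilbert polynomial of $\mathcal F$, i.e. the unique polynomial of this form with $P_{\mathcal F}(r,s)=H_{\mathcal F}(r,s)$ for all sufficiently large $r$ and $s$. Then the following statements are equivalent: 1. $e_{(d-1,0)}(\mathcal F)=0$ and $e_{(0,d-1)}(\mathcal F)=0$. 2. $I$ and $J$ are each generated by a system of parameters of $R$, $P_{\mathcal F}(r,s)=H_{\mathcal F}(r,s)$ for all $r,s\in\mathbb N$, and $\mathcal F(r,s)=I^rJ^s$ for all $r,s\in\mathbb Z$. 3. $e_\alpha(\mathcal F)=0$ for all $\alpha\in\mathbb N^2$ with $|\alpha|\le d-1$. -/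

import Mathlib

namespace BigradedHilbert

open IsLocalRing

/-- A Noetherian local ring is Cohen-Macaulay if its depth equals its dimension, i.e. if there is
a regular sequence whose length is the Krull dimension of `R`. (Since `IsRegular` requires
`(x₁, …, xₙ) ≠ R`, such a sequence lies in the maximal ideal.) -/
def IsCohenMacaulayLocal (R : Type*) [CommRing R] [IsLocalRing R] : Prop :=
  IsNoetherianRing R ∧
    ∃ rs : List R, RingTheory.Sequence.IsRegular R rs ∧
      ((rs.length : ℕ∞) : WithBot ℕ∞) = ringKrullDim R

/-- `I` is primary to the maximal ideal of the local ring `R`. -/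
def IsMaximalPrimary {R : Type*} [CommRing R] [IsLocalRing R] (I : Ideal R) : Prop :=
  I.IsPrimary ∧ I.radical = maximalIdeal R

/-- `x₁, …, x_d` is a system of parameters of the local ring `R`: `d = dim R` and
the ideal `(x₁, …, x_d)` is primary to the maximal ideal. -/
def IsSystemOfParameters {R : Type*} [CommRing R] [IsLocalRing R] {d : ℕ} (x : Fin d → R) : Prop :=
  ringKrullDim R = ((d : ℕ∞) : WithBot ℕ∞) ∧ IsMaximalPrimary (Ideal.span (Set.range x))

/-- `I` is a parameter ideal: it is generated by a system of parameters. -/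
def IsParameterIdeal {R : Type*} [CommRing R] [IsLocalRing R] (I : Ideal R) : Prop :=
  ∃ (d : ℕ) (x : Fin d → R), IsSystemOfParameters x ∧ I = Ideal.span (Set.range x)

/-- The power `I ^ n` for an integer `n`, with the convention `I ^ n = R` for `n ≤ 0`. -/
def idealZPow {R : Type*} [CommRing R] (I : Ideal R) (n : ℤ) : Ideal R :=
  I ^ n.toNat

/-- A `ℤ²`-graded `(I, J)`-filtration of ideals of `R`. -/
structure Filtration {R : Type*} [CommRing R] (I J : Ideal R) where
  /-- The ideal `F(r, s)`. -/
  ideal : ℤ → ℤ → Ideal R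
  pow_le : ∀ r s, idealZPow I r * idealZPow J s ≤ ideal r s
  mul_le : ∀ r s r' s', ideal r s * ideal r' s' ≤ ideal (r + r') (s + s')
  anti : ∀ r s r' s', r ≤ r' → s ≤ s' → ideal r' s' ≤ ideal r s

lemma idealZPow_mul_le {R : Type*} [CommRing R] (I : Ideal R) (m n : ℤ) :
    idealZPow I m * idealZPow I n ≤ idealZPow I (m + n) := by
  unfold idealZPow
  rw [← pow_add]
  exact Ideal.pow_le_pow_right (by omega)

lemma idealZPow_anti {R : Type*} [CommRing R] (I : Ideal R) {m n : ℤ} (h : m ≤ n) :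
    idealZPow I n ≤ idealZPow I m :=
  Ideal.pow_le_pow_right (by omega)

/-- The filtration `{I^r J^s}`. -/
def adicFiltration {R : Type*} [CommRing R] (I J : Ideal R) : Filtration I J where
  ideal r s := idealZPow I r * idealZPow J s
  pow_le _ _ := le_rfl
  mul_le r s r' s' := by
    rw [mul_mul_mul_comm]
    exact Ideal.mul_mono (idealZPow_mul_le I r r') (idealZPow_mul_le J s s')
  anti _ _ _ _ hr hs := Ideal.mul_mono (idealZPow_anti I hr) (idealZPow_anti J hs)

/-- The extended Rees ring `⨁ F(r, s) t₁^r t₂^s`, over all integers `r, s`, as a subalgebra of the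
Laurent polynomial ring `R[t₁^{±1}, t₂^{±1}]`. -/
def extendedReesRing {R : Type*} [CommRing R] {I J : Ideal R} (F : Filtration I J) :
    Subalgebra R (AddMonoidAlgebra R (ℤ × ℤ)) where
  carrier := {f | ∀ n : ℤ × ℤ, f.coeff n ∈ F.ideal n.1 n.2}
  mul_mem' {f g} hf hg n := by
    classical
    rw [AddMonoidAlgebra.coeff_mul]
    refine Ideal.sum_mem _ fun a _ => Ideal.sum_mem _ fun b _ => ?_
    dsimp only
    split_ifs with h
    · subst h
      exact F.mul_le _ _ _ _ (Ideal.mul_mem_mul (hf a) (hg b))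
    · exact Ideal.zero_mem _
  add_mem' {f g} hf hg n := by
    simpa using Ideal.add_mem _ (hf n) (hg n)
  algebraMap_mem' c n := by
    classical
    rw [AddMonoidAlgebra.coe_algebraMap]
    simp only [Function.comp_apply, AddMonoidAlgebra.coeff_single, Finsupp.single_apply]
    split_ifs with h
    · subst h
      have h0 := F.pow_le 0 0
      simp only [idealZPow, Int.toNat_zero, pow_zero, Ideal.one_eq_top, Ideal.mul_top] at h0
      exact h0 trivial
    · exact Ideal.zero_mem _

lemma extendedReesRing_adic_le {R : Type*} [CommRing R] {I J : Ideal R} (F : Filtration I J) :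
    extendedReesRing (adicFiltration I J) ≤ extendedReesRing F :=
  fun _ hf n => F.pow_le n.1 n.2 (hf n)

/-- The `(I, J)`-filtration `F` is admissible: `F(r, s) = F(r⁺, s⁺)` for all `r, s`, and the
extended Rees ring of `F` is a finite module over the extended Rees ring of `{I^r J^s}`. -/
structure Filtration.IsAdmissible {R : Type*} [CommRing R] {I J : Ideal R}
    (F : Filtration I J) : Prop where
  eq_posPart : ∀ r s, F.ideal r s = F.ideal (max r 0) (max s 0)
  finite : (Subalgebra.inclusion (extendedReesRing_adic_le F)).Finite

/-- The Hilbert function `H_F(r, s) = λ(R / F(r, s))`. (The length is finite when `R` is Noetherian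
local and `I`, `J` are primary to the maximal ideal.) -/
noncomputable def Filtration.hilbertFunction {R : Type*} [CommRing R] {I J : Ideal R}
    (F : Filtration I J) (r s : ℤ) : ℤ :=
  ((Module.length R (R ⧸ F.ideal r s)).toNat : ℤ)

/-- The value at `(r, s)` of the polynomial of degree at most `d` with coefficients `e_α`:
`∑_{|α| ≤ d} (-1)^(d - |α|) e_α binom(r + α₁ - 1, α₁) binom(s + α₂ - 1, α₂)`,
where `binom(x, k) = x (x - 1) ⋯ (x - k + 1) / k!` for every integer `x`. -/
noncomputable def binomialPolynomial (d : ℕ) (e : ℕ × ℕ → ℤ) (r s : ℤ) : ℤ :=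
  ∑ k ∈ Finset.range (d + 1), ∑ α ∈ Finset.HasAntidiagonal.antidiagonal k,
    (-1) ^ (d - k) * e α *
      Ring.choose (r + α.1 - 1) α.1 * Ring.choose (s + α.2 - 1) α.2

/-- `e` is the family of Hilbert coefficients of `F`, where `d` is the dimension of the ring:
the polynomial with coefficients `e_α`, `|α| ≤ d`, agrees with the Hilbert function for all large
`(r, s)`. Indices with `|α| > d` do not occur in the polynomial and get the value `0`, so that there
is at most one such family. -/
def Filtration.IsHilbertCoeff {R : Type*} [CommRing R] {I J : Ideal R}
    (F : Filtration I J) (d : ℕ) (e : ℕ × ℕ → ℤ) : Prop :=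
  (∀ α : ℕ × ℕ, d < α.1 + α.2 → e α = 0) ∧
    ∃ N : ℤ, ∀ r s : ℤ, N ≤ r → N ≤ s → F.hilbertFunction r s = binomialPolynomial d e r s

open scoped Classical in
/-- The Hilbert coefficients `e_α(F)`, where `d` is the dimension of the ring. (The value `0` in the
absence of a Hilbert polynomial never occurs for admissible filtrations.) -/
noncomputable def Filtration.hilbertCoeff {R : Type*} [CommRing R] {I J : Ideal R}
    (F : Filtration I J) (d : ℕ) : ℕ × ℕ → ℤ :=
  if h : ∃ e : ℕ × ℕ → ℤ, F.IsHilbertCoeff d e then h.choose else 0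

/-- The Hilbert polynomial `P_F`, as a function on `ℤ²`. -/
noncomputable def Filtration.hilbertPolynomial {R : Type*} [CommRing R] {I J : Ideal R}
    (F : Filtration I J) (d : ℕ) (r s : ℤ) : ℤ :=
  binomialPolynomial d (F.hilbertCoeff d) r s

end BigradedHilbert

/-!
Since the residue field is infinite, `I` contains a nonzerodivisor `a` that is superficial for `F`,
and then `H_F(r, s) - H_F(r - 1, s)` is, for large `r`, the Hilbert function of the image of `F`
in `R ⧸ (a)`, a Cohen-Macaulay ring of dimension `d - 1`. Its coefficients are
`e_(α₁ + 1, α₂)(F)`, so Hilbert polynomials exist by induction on `d`.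

If `d = 1`, the length of `R ⧸ (a)` is `e_(1, 0)`, and `a F(r, s) ⊆ F(r + 1, s)` shows that the
defect `P_F - H_F` is monotone in `r`, and likewise in `s`. It vanishes for large arguments, and at
the origin if `e_(0, 0) = 0`; so it vanishes on `ℕ²`, and comparing lengths gives `I = (a)` and
`F(r + 1, s) = a F(r, s)`.

If `d = 2` and `e_(1, 0) = 0`, the case `d = 1` applies modulo a generic `a ∈ I`; symmetrically for
`b ∈ J`. Given `r` elements of `I` and `s` elements of `J` in general position, `I^r J^s` is the
intersection of the ideals `I^r J^s + (c)`, where `c` runs through these elements, and hence it is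
equal to `F(r, s)`. The differences of `P_F` and `H_F` now agree on `ℕ²`, so `P_F = H_F` there.

Conversely, if `I = (a, z)` with `a` generic, then `λ(R / (I^r + (a))) = r λ(R / I)`, which has no
constant term, so `e_(1, 0) = 0`; and `P_F(0, 0) = H_F(0, 0) = 0` gives `e_(0, 0) = 0`.
-/

namespace BigradedHilbert

open IsLocalRing

section Colength

variable {R : Type*} [CommRing R]

/-- The length of `R ⧸ K`, as an integer. It takes the junk value `0` if the length is infinite. -/
noncomputable def colength (K : Ideal R) : ℤ :=
  (Module.length R (R ⧸ K)).toNat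

lemma length_quotient_eq_add (K : Ideal R) (a : R) :
    Module.length R (R ⧸ K) =
      Module.length R (R ⧸ K.colon {a}) + Module.length R (R ⧸ (K ⊔ Ideal.span {a})) := by
  let f : R →ₗ[R] R ⧸ K := K.mkQ ∘ₗ LinearMap.mulRight R a
  have hker : f.ker = K.colon {a} := by
    ext x
    simp [f, Submodule.mem_colon_singleton, -map_mul, Ideal.Quotient.eq_zero_iff_mem]
  have hrange : f.range = Submodule.map K.mkQ (Ideal.span {a}) := by
    rw [LinearMap.range_comp]
    congr 1
    ext x
    simp [Ideal.mem_span_singleton']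
  rw [Module.length_eq_add_of_exact f.range.subtype f.range.mkQ (Submodule.subtype_injective _)
    (Submodule.mkQ_surjective _) (LinearMap.exact_subtype_mkQ _),
    ← f.quotKerEquivRange.length_eq, hker, hrange,
    (Submodule.quotientQuotientEquivQuotientSup K (Ideal.span {a})).length_eq]

lemma colength_top : colength (⊤ : Ideal R) = 0 := by
  have : Subsingleton (R ⧸ (⊤ : Ideal R)) := Ideal.Quotient.subsingleton_iff.mpr rfl
  simp [colength]

lemma colength_map_quotient (K L : Ideal R) :
    colength (K.map (Ideal.Quotient.mk L)) = colength (K ⊔ L) := by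
  unfold colength
  rw [← Module.length_eq_of_surjective (R := R ⧸ L) (M := (R ⧸ L) ⧸ K.map (Ideal.Quotient.mk L))
    Ideal.Quotient.mk_surjective, sup_comm]
  congr 2
  exact (DoubleQuot.quotQuotEquivQuotSupₐ R L K).toLinearEquiv.length_eq

variable [IsLocalRing R]

/-- `K` contains a power of the maximal ideal: it is the unit ideal or primary to the maximal
ideal. -/
def ContainsMaxPow (K : Ideal R) : Prop := ∃ k : ℕ, maximalIdeal R ^ k ≤ K

lemma ContainsMaxPow.mono {K K' : Ideal R} (h : ContainsMaxPow K) (hK : K ≤ K') :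
    ContainsMaxPow K' :=
  h.imp fun _ hk => hk.trans hK

lemma ContainsMaxPow.mul {K K' : Ideal R} (h : ContainsMaxPow K) (h' : ContainsMaxPow K') :
    ContainsMaxPow (K * K') := by
  obtain ⟨k, hk⟩ := h
  obtain ⟨k', hk'⟩ := h'
  exact ⟨k + k', (pow_add _ k k').le.trans (Ideal.mul_mono hk hk')⟩

lemma ContainsMaxPow.pow {K : Ideal R} (h : ContainsMaxPow K) (n : ℕ) : ContainsMaxPow (K ^ n) := by
  obtain ⟨k, hk⟩ := h
  exact ⟨k * n, (pow_mul _ k n).le.trans (Ideal.pow_right_mono hk n)⟩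

lemma ContainsMaxPow.map {K : Ideal R} (h : ContainsMaxPow K) {S : Type*} [CommRing S]
    [IsLocalRing S] {f : R →+* S} (hf : Function.Surjective f) : ContainsMaxPow (K.map f) := by
  obtain ⟨k, hk⟩ := h
  refine ⟨k, ?_⟩
  rw [← map_maximalIdeal_of_surjective f hf, ← Ideal.map_pow]
  exact Ideal.map_mono hk

variable [IsNoetherianRing R]

lemma ContainsMaxPow.isArtinianRing_quotient {K : Ideal R} (h : ContainsMaxPow K) :
    IsArtinianRing (R ⧸ K) := by
  obtain rfl | hK := eq_or_ne K ⊤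
  · have : Subsingleton (R ⧸ (⊤ : Ideal R)) := Ideal.Quotient.subsingleton_iff.mpr rfl
    infer_instance
  · obtain ⟨k, hk⟩ := h
    refine quotient_artinian_of_mem_minimalPrimes_of_isLocalRing K
      ⟨⟨inferInstance, le_maximalIdeal hK⟩, fun P hP _ => ?_⟩
    exact hP.1.le_of_pow_le (hk.trans hP.2)

lemma ContainsMaxPow.length_ne_top {K : Ideal R} (h : ContainsMaxPow K) :
    Module.length R (R ⧸ K) ≠ ⊤ := by
  have := h.isArtinianRing_quotient
  rw [Module.length_eq_of_surjective (R := R ⧸ K) (M := R ⧸ K) Ideal.Quotient.mk_surjective]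
  exact Module.length_ne_top

lemma ContainsMaxPow.colength_eq_add {K : Ideal R} (h : ContainsMaxPow K) (a : R) :
    colength K = colength (K.colon {a}) + colength (K ⊔ Ideal.span {a}) := by
  unfold colength
  rw [length_quotient_eq_add K a, ENat.toNat_add, Nat.cast_add]
  · exact (h.mono Ideal.le_colon).length_ne_top
  · exact (h.mono le_sup_left).length_ne_top

lemma ContainsMaxPow.colength_le {K K' : Ideal R} (h : ContainsMaxPow K) (hK : K ≤ K') :
    colength K' ≤ colength K := by
  have := Module.length_le_of_surjective (Submodule.factor hK) (Submodule.factor_surjective hK)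
  exact Nat.cast_le.mpr (ENat.toNat_le_toNat this h.length_ne_top)

lemma ContainsMaxPow.eq_of_colength_le {K K' : Ideal R} (h : ContainsMaxPow K) (hK : K ≤ K')
    (hc : colength K ≤ colength K') : K = K' := by
  refine le_antisymm hK fun x hx => ?_
  have hadd := h.colength_eq_add x
  have hle := h.mono (le_sup_left : K ≤ K ⊔ Ideal.span {x}) |>.colength_le
    (sup_le hK ((Ideal.span_singleton_le_iff_mem _).mpr hx))
  have hzero : Module.length R (R ⧸ K.colon {x}) = 0 := by
    have : colength (K.colon {x}) ≤ 0 := by linarith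
    simpa [colength, (h.mono Ideal.le_colon).length_ne_top] using this
  rw [Module.length_eq_zero_iff, Ideal.Quotient.subsingleton_iff,
    Submodule.colon_eq_top_iff_subset] at hzero
  simpa using hzero

lemma containsMaxPow_span_singleton (hd : ringKrullDim R ≤ 1) {a : R}
    (ha : a ∈ nonZeroDivisors R) : ContainsMaxPow (Ideal.span {a}) := by
  have : Ring.KrullDimLE 1 R := Ring.krullDimLE_iff.mpr hd
  have := (isFiniteLength_iff_isNoetherian_isArtinian.mp
    (isFiniteLength_quotient_span_singleton R ha)).2
  have : IsArtinianRing (R ⧸ Ideal.span {a}) := isArtinian_of_tower R this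
  exact exists_maximalIdeal_pow_le_of_isArtinianRing_quotient _

lemma isMaximalPrimary_iff {I : Ideal R} :
    IsMaximalPrimary I ↔ ContainsMaxPow I ∧ I ≤ maximalIdeal R := by
  refine ⟨fun hI => ⟨?_, hI.2 ▸ Ideal.le_radical⟩, fun ⟨⟨k, hk⟩, hI⟩ => ?_⟩
  · exact Ideal.exists_pow_le_of_le_radical_of_fg hI.2.ge (IsNoetherian.noetherian _)
  · have hrad : I.radical = maximalIdeal R :=
      le_antisymm ((Ideal.radical_mono hI).trans (maximalIdeal.isMaximal R).isPrime.radical.le)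
        fun x hx => ⟨k, hk (Ideal.pow_mem_pow hx k)⟩
    exact ⟨Ideal.isPrimary_of_isMaximal_radical (hrad ▸ maximalIdeal.isMaximal R), hrad⟩

lemma IsMaximalPrimary.containsMaxPow {I : Ideal R} (hI : IsMaximalPrimary I) : ContainsMaxPow I :=
  (isMaximalPrimary_iff.mp hI).1

lemma IsMaximalPrimary.le_maximalIdeal {I : Ideal R} (hI : IsMaximalPrimary I) :
    I ≤ maximalIdeal R :=
  (isMaximalPrimary_iff.mp hI).2

lemma IsMaximalPrimary.map {I : Ideal R} (hI : IsMaximalPrimary I) {S : Type*} [CommRing S]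
    [IsLocalRing S] [IsNoetherianRing S] {f : R →+* S} (hf : Function.Surjective f) :
    IsMaximalPrimary (I.map f) := by
  refine isMaximalPrimary_iff.mpr ⟨hI.containsMaxPow.map hf, ?_⟩
  rw [← map_maximalIdeal_of_surjective f hf]
  exact Ideal.map_mono hI.le_maximalIdeal

end Colength

section Generic

variable {R : Type*} [CommRing R]

/-- The property `p` holds for every element of `I` outside finitely many ideals, none of which
contains `I`. If the residue field is infinite, such elements exist. -/
def Generic (I : Ideal R) (p : R → Prop) : Prop :=
  ∃ S : Set (Ideal R), S.Finite ∧ (∀ V ∈ S, ¬ I ≤ V) ∧ ∀ a ∈ I, (∀ V ∈ S, a ∉ V) → p a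

lemma Generic.mono {I : Ideal R} {p q : R → Prop} (h : Generic I p) (hpq : ∀ a ∈ I, p a → q a) :
    Generic I q := by
  obtain ⟨S, hS, hV, H⟩ := h
  exact ⟨S, hS, hV, fun a ha h => hpq a ha (H a ha h)⟩

lemma Generic.and {I : Ideal R} {p q : R → Prop} (h : Generic I p) (h' : Generic I q) :
    Generic I (fun a => p a ∧ q a) := by
  obtain ⟨S, hS, hV, H⟩ := h
  obtain ⟨S', hS', hV', H'⟩ := h'
  exact ⟨S ∪ S', hS.union hS', fun V => Or.rec (hV V) (hV' V), fun a ha h =>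
    ⟨H a ha fun V hm => h V (Or.inl hm), H' a ha fun V hm => h V (Or.inr hm)⟩⟩

lemma generic_notMem {I V : Ideal R} (h : ¬ I ≤ V) : Generic I (fun a => a ∉ V) :=
  ⟨{V}, Set.finite_singleton V, by simpa using h, fun _ _ h => h V rfl⟩

lemma generic_forall_list {ι : Type*} {I : Ideal R} {p : ι → R → Prop} (l : List ι)
    (h : ∀ i ∈ l, Generic I (p i)) : Generic I (fun a => ∀ i ∈ l, p i a) := by
  induction l with
  | nil => exact ⟨∅, Set.finite_empty, by simp, by simp⟩
  | cons i l ih =>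
    simp only [List.forall_mem_cons] at h ⊢
    exact h.1.and (ih h.2)

variable [IsLocalRing R]

lemma finite_residueField_of_finite_quotient {M : Type*} [AddCommGroup M] [Module R M]
    {N : Submodule R M} (hN : N ≠ ⊤) [Finite (M ⧸ N)] : Finite (ResidueField R) := by
  obtain ⟨y, -, hy⟩ := SetLike.exists_of_lt hN.lt_top
  let f : R →ₗ[R] M ⧸ N := LinearMap.toSpanSingleton R _ (N.mkQ y)
  have hf : f.ker ≠ ⊤ := fun h =>
    hy (by simpa [f] using LinearMap.congr_fun (LinearMap.ker_eq_top.mp h) 1)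
  have : Finite (R ⧸ f.ker) := .of_equiv _ f.quotKerEquivRange.symm.toEquiv
  exact .of_surjective (Ideal.Quotient.factor (le_maximalIdeal hf))
    (Ideal.Quotient.factor_surjective _)

variable [Infinite (ResidueField R)]

lemma Generic.exists {I : Ideal R} {p : R → Prop} (h : Generic I p) : ∃ a ∈ I, p a := by
  obtain ⟨S, hS, hV, H⟩ := h
  by_contra! hcon
  have hcov : ⋃ V ∈ hS.toFinset, (Submodule.comap I.subtype V : Set I) = Set.univ := by
    refine Set.eq_univ_iff_forall.mpr fun ⟨a, ha⟩ => ?_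
    by_contra hn
    exact hcon a ha (H a ha fun V hVS haV =>
      hn (Set.mem_biUnion (hS.mem_toFinset.mpr hVS) haV))
  obtain ⟨V, hVS, _⟩ := Submodule.exists_finiteIndex_of_cover hcov
  have : Finite (I ⧸ Submodule.comap I.subtype V) := AddSubgroup.finite_quotient_of_finiteIndex
  refine not_finite_iff_infinite.mpr ‹Infinite (ResidueField R)›
    (finite_residueField_of_finite_quotient (N := Submodule.comap I.subtype V) fun htop => ?_)
  exact hV V (hS.mem_toFinset.mp hVS) (Submodule.comap_subtype_eq_top.mp htop)

end Generic

section Depth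

variable {R : Type*} [CommRing R] [IsLocalRing R]

/-- The depth of `R ⧸ K` is positive: no nonzero element of `R ⧸ K` is annihilated by the maximal
ideal. -/
def DepthPos (K : Ideal R) : Prop :=
  ∀ z, (∀ u ∈ maximalIdeal R, u * z ∈ K) → z ∈ K

lemma DepthPos.mem_of_containsMaxPow {K N : Ideal R} (h : DepthPos K) (hN : ContainsMaxPow N)
    {z : R} (hz : ∀ u ∈ N, u * z ∈ K) : z ∈ K := by
  obtain ⟨k, hk⟩ := hN
  replace hz : ∀ u ∈ maximalIdeal R ^ k, u * z ∈ K := fun u hu => hz u (hk hu)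
  clear hk
  induction k with
  | zero => simpa using hz 1 (by simp)
  | succ k ih =>
    refine ih fun u hu => h _ fun v hv => ?_
    rw [← mul_assoc]
    exact hz _ (pow_succ' (maximalIdeal R) k ▸ Ideal.mul_mem_mul hv hu)

lemma DepthPos.not_containsMaxPow {K : Ideal R} (h : DepthPos K) (hK : K ≠ ⊤) :
    ¬ ContainsMaxPow K := fun hc =>
  hK ((Ideal.eq_top_iff_one K).mpr (h.mem_of_containsMaxPow hc fun _ hu => K.mul_mem_right _ hu))

lemma DepthPos.mem_of_mul_mem {a : R} {K : Ideal R} (h : DepthPos K)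
    (hac : ContainsMaxPow (Ideal.span {a} ⊔ K)) {z : R} (hz : a * z ∈ K) : z ∈ K := by
  refine h.mem_of_containsMaxPow hac fun u hu => ?_
  obtain ⟨t, w, hw, rfl⟩ := Ideal.mem_span_singleton_sup.mp hu
  rw [add_mul, mul_assoc]
  exact K.add_mem (K.mul_mem_left _ hz) (K.mul_mem_right _ hw)

lemma DepthPos.of_span_singleton {x a : R} (hx : x ∈ nonZeroDivisors R)
    (ha : a ∈ nonZeroDivisors R) (hxm : x ∈ maximalIdeal R) (h : DepthPos (Ideal.span {x})) :
    DepthPos (Ideal.span {a}) := by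
  -- Writing `x z = w a`, the map `z ↦ w` identifies `(a : 𝔪) / (a)` with `(x : 𝔪) / (x)`.
  intro z hz
  obtain ⟨w, hw⟩ := Ideal.mem_span_singleton'.mp (hz x hxm)
  have hwx : w ∈ Ideal.span {x} := by
    refine h w fun u hu => ?_
    obtain ⟨t, ht⟩ := Ideal.mem_span_singleton'.mp (hz u hu)
    refine Ideal.mem_span_singleton'.mpr ⟨t, ?_⟩
    refine (mul_cancel_right_mem_nonZeroDivisors ha).mp ?_
    linear_combination x * ht - u * hw
  obtain ⟨v, rfl⟩ := Ideal.mem_span_singleton'.mp hwx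
  refine Ideal.mem_span_singleton'.mpr ⟨v, ?_⟩
  refine (mul_cancel_left_mem_nonZeroDivisors hx).mp ?_
  linear_combination hw

lemma DepthPos.quotient {K : Ideal R} [IsLocalRing (R ⧸ K)] (h : DepthPos K) :
    DepthPos (⊥ : Ideal (R ⧸ K)) := by
  intro z hz
  obtain ⟨z, rfl⟩ := Ideal.Quotient.mk_surjective z
  refine Ideal.Quotient.eq_zero_iff_mem.mpr (h z fun u hu => Ideal.Quotient.eq_zero_iff_mem.mp ?_)
  rw [map_mul]
  refine hz _ ?_
  rw [← map_maximalIdeal_of_surjective _ Ideal.Quotient.mk_surjective]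
  exact Ideal.mem_map_of_mem _ hu

lemma generic_mem_nonZeroDivisors [IsNoetherianRing R] (h : DepthPos (⊥ : Ideal R)) {I : Ideal R}
    (hI : IsMaximalPrimary I) : Generic I (fun a => a ∈ nonZeroDivisors R) := by
  refine ⟨associatedPrimes R R, associatedPrimes.finite R R, fun P hP hle => ?_, fun a _ ha => ?_⟩
  · obtain ⟨hPp, z, hz⟩ := (AssociatedPrimes.mem_iff.trans isAssociatedPrime_iff).mp hP
    obtain ⟨k, hk⟩ := hI.containsMaxPow
    have hmP : maximalIdeal R ≤ P := hPp.le_of_pow_le (hk.trans hle)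
    have hz0 : z ∈ (⊥ : Ideal R) := h z fun u hu =>
      Submodule.mem_colon_singleton.mp (hz ▸ hmP hu)
    rw [Ideal.mem_bot.mp hz0, Submodule.colon_singleton_zero] at hz
    exact hPp.ne_top hz
  · by_contra hn
    have : a ∈ (nonZeroDivisors R : Set R)ᶜ := hn
    rw [← biUnion_associatedPrimes_eq_compl_nonZeroDivisors] at this
    obtain ⟨P, hP, haP⟩ := Set.mem_iUnion₂.mp this
    exact ha P hP haP

lemma infinite_residueField_quotient [Infinite (ResidueField R)] (K : Ideal R)
    [IsLocalRing (R ⧸ K)] : Infinite (ResidueField (R ⧸ K)) := by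
  have : IsLocalHom (Ideal.Quotient.mk K) := .of_surjective _ Ideal.Quotient.mk_surjective
  exact .of_injective _ (ResidueField.map (Ideal.Quotient.mk K)).injective

end Depth

section CohenMacaulay

open RingTheory.Sequence Pointwise

variable {R : Type*} [CommRing R]

lemma mem_nonZeroDivisors_of_isRegular_cons {x : R} {rs : List R} (h : IsRegular R (x :: rs)) :
    x ∈ nonZeroDivisors R := by
  rw [mem_nonZeroDivisors_iff_left]
  intro z hz
  refine ((isWeaklyRegular_cons_iff R x rs).mp h.toIsWeaklyRegular).1 ?_
  simpa using hz

variable [IsLocalRing R]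

lemma mem_maximalIdeal_of_isRegular {rs : List R} (h : IsRegular R rs) {x : R} (hx : x ∈ rs) :
    x ∈ maximalIdeal R := by
  rw [mem_maximalIdeal, mem_nonunits_iff]
  intro hu
  refine h.top_ne_smul ?_
  have htop : Ideal.ofList rs = ⊤ := Ideal.eq_top_of_isUnit_mem _ (Ideal.subset_span hx) hu
  simp [htop]

lemma depthPos_bot_of_mem_nonZeroDivisors {x : R} (hx : x ∈ nonZeroDivisors R)
    (hxm : x ∈ maximalIdeal R) : DepthPos (⊥ : Ideal R) :=
  fun _ hz => (mul_left_mem_nonZeroDivisors_eq_zero_iff hx).mp (hz x hxm)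

lemma depthPos_span_singleton_of_isRegular {x y : R} (h : IsRegular R [x, y]) :
    DepthPos (Ideal.span {x}) := by
  have hmem (z : R) : z ∈ x • (⊤ : Submodule R R) ↔ z ∈ Ideal.span {x} := by
    rw [Submodule.mem_smul_pointwise_iff_exists, Ideal.mem_span_singleton']
    simp [mul_comm]
  have hy := ((isWeaklyRegular_cons_iff R x [y]).mp h.toIsWeaklyRegular).2
  replace hy := ((isWeaklyRegular_cons_iff _ y []).mp hy).1
  intro z hz
  rw [← hmem, ← Submodule.Quotient.mk_eq_zero]
  refine hy ?_
  dsimp only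
  rw [smul_zero, ← Submodule.Quotient.mk_smul, Submodule.Quotient.mk_eq_zero, hmem]
  exact hz y (mem_maximalIdeal_of_isRegular h (by simp))

lemma IsCohenMacaulayLocal.exists_isRegular (h : IsCohenMacaulayLocal R) {d : ℕ}
    (hd : ringKrullDim R = ((d : ℕ∞) : WithBot ℕ∞)) :
    ∃ rs : List R, IsRegular R rs ∧ rs.length = d := by
  obtain ⟨-, rs, hrs, hlen⟩ := h
  exact ⟨rs, hrs, by simpa [hd] using hlen⟩

lemma IsCohenMacaulayLocal.depthPos_bot (h : IsCohenMacaulayLocal R) {d : ℕ}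
    (hd : ringKrullDim R = ((d : ℕ∞) : WithBot ℕ∞)) (hd1 : 1 ≤ d) : DepthPos (⊥ : Ideal R) := by
  obtain ⟨_ | ⟨x, rs⟩, hrs, rfl⟩ := h.exists_isRegular hd
  · contradiction
  · exact depthPos_bot_of_mem_nonZeroDivisors (mem_nonZeroDivisors_of_isRegular_cons hrs)
      (mem_maximalIdeal_of_isRegular hrs (by simp))

lemma IsCohenMacaulayLocal.depthPos_span_singleton (h : IsCohenMacaulayLocal R)
    (hd : ringKrullDim R = ((2 : ℕ∞) : WithBot ℕ∞)) {a : R} (ha : a ∈ nonZeroDivisors R) :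
    DepthPos (Ideal.span {a}) := by
  obtain ⟨rs, hrs, hlen⟩ := h.exists_isRegular (d := 2) hd
  obtain ⟨x, y, rfl⟩ := List.length_eq_two.mp hlen
  exact (depthPos_span_singleton_of_isRegular hrs).of_span_singleton
    (mem_nonZeroDivisors_of_isRegular_cons hrs) ha (mem_maximalIdeal_of_isRegular hrs (by simp))

end CohenMacaulay

section BinomialPolynomial

lemma choose_sub_choose (x : ℤ) (k : ℕ) :
    Ring.choose (x + (k + 1 : ℕ) - 1) (k + 1) - Ring.choose (x - 1 + (k + 1 : ℕ) - 1) (k + 1) =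
      Ring.choose (x + k - 1) k := by
  have h := Ring.choose_succ_succ (x + k - 1) k
  have h1 : x + (k + 1 : ℕ) - 1 = x + k - 1 + 1 := by push_cast; ring
  have h2 : x - 1 + (k + 1 : ℕ) - 1 = x + k - 1 := by push_cast; ring
  rw [h1, h2, h, add_sub_cancel_right]

lemma binomialPolynomial_sub_left (d : ℕ) (e : ℕ × ℕ → ℤ) (r s : ℤ) :
    binomialPolynomial (d + 1) e r s - binomialPolynomial (d + 1) e (r - 1) s =
      binomialPolynomial d (fun α => e (α.1 + 1, α.2)) r s := by
  simp only [binomialPolynomial, ← Finset.sum_sub_distrib]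
  rw [Finset.sum_range_succ']
  simp only [Finset.Nat.sum_antidiagonal_succ, Finset.Nat.antidiagonal_zero, Finset.sum_singleton,
    Ring.choose_zero_right, sub_self, add_zero, zero_add, Nat.reduceSubDiff]
  refine Finset.sum_congr rfl fun k _ => Finset.sum_congr rfl fun α _ => ?_
  rw [← choose_sub_choose r α.1]
  ring

lemma binomialPolynomial_swap (d : ℕ) (e : ℕ × ℕ → ℤ) (r s : ℤ) :
    binomialPolynomial d (fun α => e α.swap) s r = binomialPolynomial d e r s := by
  refine Finset.sum_congr rfl fun k _ => ?_
  rw [← Finset.Nat.sum_antidiagonal_swap]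
  refine Finset.sum_congr rfl fun α _ => ?_
  simp only [Prod.swap_swap, Prod.fst_swap, Prod.snd_swap]
  ring

lemma binomialPolynomial_sub_right (d : ℕ) (e : ℕ × ℕ → ℤ) (r s : ℤ) :
    binomialPolynomial (d + 1) e r s - binomialPolynomial (d + 1) e r (s - 1) =
      binomialPolynomial d (fun α => e (α.1, α.2 + 1)) r s := by
  simp only [← binomialPolynomial_swap _ _ r]
  exact binomialPolynomial_sub_left d (fun α => e α.swap) s r

lemma binomialPolynomial_sub (d : ℕ) (e e' : ℕ × ℕ → ℤ) (r s : ℤ) :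
    binomialPolynomial d e r s - binomialPolynomial d e' r s =
      binomialPolynomial d (e - e') r s := by
  simp only [binomialPolynomial, ← Finset.sum_sub_distrib, Pi.sub_apply]
  refine Finset.sum_congr rfl fun k _ => Finset.sum_congr rfl fun α _ => ?_
  ring

lemma binomialPolynomial_eq_of_ne_zero {d : ℕ} {e : ℕ × ℕ → ℤ} {r s : ℤ}
    (h : ∀ α ≠ 0, e α * Ring.choose (r + α.1 - 1) α.1 * Ring.choose (s + α.2 - 1) α.2 = 0) :
    binomialPolynomial d e r s = (-1) ^ d * e 0 := by
  rw [binomialPolynomial, Finset.sum_range_succ', Finset.sum_eq_zero, zero_add]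
  · simp [Prod.zero_eq_mk]
  · refine fun k _ => Finset.sum_eq_zero fun α hα => ?_
    rw [mul_assoc, mul_assoc, ← mul_assoc (e α), h α (by rintro rfl; simp at hα), mul_zero]

lemma binomialPolynomial_zero_zero (d : ℕ) (e : ℕ × ℕ → ℤ) :
    binomialPolynomial d e 0 0 = (-1) ^ d * e 0 := by
  have hchoose (k : ℕ) : Ring.choose ((0 : ℤ) + (k + 1 : ℕ) - 1) (k + 1) = 0 := by
    rw [zero_add, Nat.cast_succ, add_sub_cancel_right, Ring.choose_natCast, Nat.choose_succ_self,
      Nat.cast_zero]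
  refine binomialPolynomial_eq_of_ne_zero fun α hα => ?_
  obtain ⟨_ | a, _ | b⟩ := α
  · exact absurd rfl hα
  all_goals simp only [hchoose, mul_zero, zero_mul]

lemma binomialPolynomial_one (e : ℕ × ℕ → ℤ) (r s : ℤ) :
    binomialPolynomial 1 e r s = e (1, 0) * r + e (0, 1) * s - e (0, 0) := by
  simp [binomialPolynomial, Finset.sum_range_succ, Finset.Nat.sum_antidiagonal_succ]
  ring

lemma eq_of_differences_eq_zero {D : ℤ → ℤ → ℤ} {N : ℤ}
    (hr : ∀ r s, N ≤ r → N ≤ s → D (r + 1) s = D r s)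
    (hs : ∀ r s, N ≤ r → N ≤ s → D r (s + 1) = D r s) {r s : ℤ} (hNr : N ≤ r) (hNs : N ≤ s) :
    D r s = D N N := by
  trans D N s
  · induction r, hNr using Int.leInduction with
    | base => rfl
    | succ r hNr ih => rw [hr r s hNr hNs, ih]
  · induction s, hNs using Int.leInduction with
    | base => rfl
    | succ s hNs ih => rw [hs N s le_rfl hNs, ih]

/-- For large arguments, `H` agrees with the polynomial of degree at most `d` whose coefficients in
the binomial basis are `e`; the coefficients `e α` with `|α| > d`, which do not occur in this
polynomial, are `0`. For the Hilbert function of a filtration this is `IsHilbertCoeff`. -/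
def HasBinomialCoeff (H : ℤ → ℤ → ℤ) (d : ℕ) (e : ℕ × ℕ → ℤ) : Prop :=
  (∀ α : ℕ × ℕ, d < α.1 + α.2 → e α = 0) ∧
    ∃ N : ℤ, ∀ r s : ℤ, N ≤ r → N ≤ s → H r s = binomialPolynomial d e r s

lemma hasBinomialCoeff_zero {H : ℤ → ℤ → ℤ} {c N : ℤ}
    (h : ∀ r s, N ≤ r → N ≤ s → H r s = c) : HasBinomialCoeff H 0 (Pi.single 0 c) := by
  have hne {α : ℕ × ℕ} (hα : 0 < α.1 + α.2) : α ≠ 0 := by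
    rintro rfl
    simp at hα
  refine ⟨fun α hα => by simp [hne hα], N, fun r s hr hs => ?_⟩
  rw [h r s hr hs, binomialPolynomial_eq_of_ne_zero fun α hα => by simp [hα]]
  simp

namespace HasBinomialCoeff

variable {H : ℤ → ℤ → ℤ} {d : ℕ} {e e' e'' : ℕ × ℕ → ℤ}

lemma swap (h : HasBinomialCoeff H d e) :
    HasBinomialCoeff (fun r s => H s r) d (fun α => e α.swap) := by
  obtain ⟨he, N, hN⟩ := h
  refine ⟨fun α hα => he _ (by rwa [Prod.fst_swap, Prod.snd_swap, add_comm]), N,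
    fun r s hr hs => ?_⟩
  exact (hN s r hs hr).trans (binomialPolynomial_swap d e s r).symm

lemma sub_left (h : HasBinomialCoeff H d e) :
    HasBinomialCoeff (fun r s => H r s - H (r - 1) s) (d - 1) (fun α => e (α.1 + 1, α.2)) := by
  obtain ⟨he, N, hN⟩ := h
  refine ⟨fun α hα => he _ (by dsimp only; omega), N + 1, fun r s hr hs => ?_⟩
  dsimp only
  rw [hN r s (by omega) (by omega), hN (r - 1) s (by omega) (by omega)]
  cases d with
  | zero => simp [binomialPolynomial, he]
  | succ d => exact binomialPolynomial_sub_left d e r s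

lemma sub_right (h : HasBinomialCoeff H d e) :
    HasBinomialCoeff (fun r s => H r s - H r (s - 1)) (d - 1) (fun α => e (α.1, α.2 + 1)) :=
  h.swap.sub_left.swap

lemma ext_of_ne_zero (h : HasBinomialCoeff H d e) (h' : HasBinomialCoeff H d e')
    (hne : ∀ α ≠ 0, e α = e' α) : e = e' := by
  obtain ⟨-, N, hN⟩ := h
  obtain ⟨-, N', hN'⟩ := h'
  have hsub := binomialPolynomial_sub d e e' (max N N') (max N N')
  rw [← hN _ _ (le_max_left _ _) (le_max_left _ _), ← hN' _ _ (le_max_right _ _) (le_max_right _ _),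
    sub_self, binomialPolynomial_eq_of_ne_zero (by simp +contextual [hne])] at hsub
  funext α
  by_cases hα : α = 0
  · simpa [hα, sub_eq_zero, eq_comm (a := (0 : ℤ))] using hsub
  · exact hne α hα

lemma unique (h : HasBinomialCoeff H d e) (h' : HasBinomialCoeff H d e') : e = e' := by
  induction d generalizing H e e' with
  | zero =>
    refine h.ext_of_ne_zero h' fun α hα => ?_
    have : 0 < α.1 + α.2 := by
      contrapose! hα
      ext <;> simp <;> omega
    rw [h.1 α this, h'.1 α this]
  | succ d ih =>
    refine h.ext_of_ne_zero h' fun α hα => ?_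
    obtain ⟨_ | a, _ | b⟩ := α
    · exact absurd rfl hα
    · exact congrFun (ih h.sub_right h'.sub_right) (0, b)
    · exact congrFun (ih h.sub_left h'.sub_left) (a, 0)
    · exact congrFun (ih h.sub_left h'.sub_left) (a, b + 1)

lemma exists_succ_of_sub_eq {N : ℤ} (he : ∀ α : ℕ × ℕ, d + 1 < α.1 + α.2 → e α = 0)
    (hl : ∀ r s, N ≤ r → N ≤ s →
      H r s - H (r - 1) s = binomialPolynomial d (fun α => e (α.1 + 1, α.2)) r s)
    (hr : ∀ r s, N ≤ r → N ≤ s →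
      H r s - H r (s - 1) = binomialPolynomial d (fun α => e (α.1, α.2 + 1)) r s) :
    ∃ e, HasBinomialCoeff H (d + 1) e := by
  let D (r s : ℤ) : ℤ := H r s - binomialPolynomial (d + 1) e r s
  have hD {r s : ℤ} (hr' : N ≤ r) (hs' : N ≤ s) : D r s = D N N := by
    refine eq_of_differences_eq_zero (fun r s hr' hs' => ?_) (fun r s hr' hs' => ?_) hr' hs'
    · have h := hl (r + 1) s (by omega) hs'
      have h' := binomialPolynomial_sub_left d e (r + 1) s
      rw [add_sub_cancel_right] at h h'
      linarith
    · have h := hr r (s + 1) hr' (by omega)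
      have h' := binomialPolynomial_sub_right d e r (s + 1)
      rw [add_sub_cancel_right] at h h'
      linarith
  let δ : ℕ × ℕ → ℤ := Pi.single 0 ((-1) ^ (d + 1) * D N N)
  have hδ0 : δ 0 = (-1) ^ (d + 1) * D N N := Pi.single_eq_same _ _
  have hδ {α : ℕ × ℕ} (hα : α ≠ 0) : δ α = 0 := Pi.single_eq_of_ne hα _
  refine ⟨e + δ, fun α hα => ?_, N, fun r s hr' hs' => ?_⟩
  · rw [Pi.add_apply, he α hα, hδ (by rintro rfl; simp at hα), add_zero]
  · have hδD : binomialPolynomial (d + 1) δ r s = D r s := by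
      rw [binomialPolynomial_eq_of_ne_zero fun α hα => by rw [hδ hα, zero_mul, zero_mul],
        hδ0, ← mul_assoc, ← mul_pow, neg_one_mul, neg_neg, one_pow, one_mul,
        hD hr' hs']
    have h := binomialPolynomial_sub (d + 1) (e + δ) e r s
    rw [add_sub_cancel_left, hδD] at h
    linarith

lemma exists_succ (hl : HasBinomialCoeff (fun r s => H r s - H (r - 1) s) d e')
    (hr : HasBinomialCoeff (fun r s => H r s - H r (s - 1)) d e'') :
    ∃ e, HasBinomialCoeff H (d + 1) e := by
  have hcompat (a b : ℕ) : e' (a, b + 1) = e'' (a + 1, b) := by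
    have h := hl.sub_right
    have h' := hr.sub_left
    have hcomm : (fun r s => H r s - H (r - 1) s - (H r (s - 1) - H (r - 1) (s - 1))) =
        fun r s => H r s - H r (s - 1) - (H (r - 1) s - H (r - 1) (s - 1)) := by
      ext r s
      ring
    exact congrFun (h.unique (hcomm ▸ h')) (a, b)
  let e : ℕ × ℕ → ℤ
    | (a + 1, b) => e' (a, b)
    | (0, b + 1) => e'' (0, b)
    | (0, 0) => 0
  obtain ⟨he', N', hN'⟩ := hl
  obtain ⟨he'', N'', hN''⟩ := hr
  refine exists_succ_of_sub_eq (e := e) (N := max N' N'') ?_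
    (fun r s hr hs => hN' r s (by omega) (by omega)) fun r s hr hs => ?_
  · rintro ⟨_ | a, _ | b⟩ hα
    all_goals first | rfl | exact he' _ (by dsimp at *; omega) | exact he'' _ (by dsimp at *; omega)
  · have : e'' = fun α => e (α.1, α.2 + 1) := by
      ext ⟨_ | a, b⟩
      · rfl
      · exact (hcompat a b).symm
    exact this ▸ hN'' r s (by omega) (by omega)

end HasBinomialCoeff

lemma Filtration.isHilbertCoeff_hilbertCoeff {R : Type*} [CommRing R] {I J : Ideal R}
    {F : Filtration I J} {d : ℕ} (h : ∃ e, F.IsHilbertCoeff d e) :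
    F.IsHilbertCoeff d (F.hilbertCoeff d) := by
  unfold Filtration.hilbertCoeff
  rw [dif_pos h]
  exact h.choose_spec

end BinomialPolynomial

section FilterRegular

lemma Generic.comap {R A : Type*} [CommRing R] [CommRing A] [Algebra R A] {K : Ideal R}
    (φ : K →ₗ[R] A) {p : A → Prop} (h : Generic (Ideal.span (Set.range φ)) p) :
    Generic K (fun a => ∀ ha : a ∈ K, p (φ ⟨a, ha⟩)) := by
  obtain ⟨S, hS, hV, H⟩ := h
  let V (P : Ideal A) : Ideal R :=
    Submodule.map K.subtype (Submodule.comap φ (P.restrictScalars R))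
  have hmem {P : Ideal A} {a : K} : a.1 ∈ V P ↔ φ a ∈ P :=
    Submodule.mem_map.trans ⟨fun ⟨b, hb, hba⟩ => Subtype.ext hba ▸ hb, fun ha => ⟨a, ha, rfl⟩⟩
  refine ⟨V '' S, hS.image V, ?_, fun a _ hav ha => ?_⟩
  · rintro _ ⟨P, hP, rfl⟩ hle
    refine hV P hP (Ideal.span_le.mpr ?_)
    rintro _ ⟨a, rfl⟩
    exact hmem.mp (hle a.2)
  · exact H _ (Ideal.subset_span ⟨_, rfl⟩) fun P hP hzP =>
      hav _ ⟨P, hP, rfl⟩ (hmem (a := ⟨a, ha⟩).mpr hzP)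

variable {A L : Type*} [CommRing A] [AddCommGroup L] [Module A L] {E : Submodule A L}

lemma fg_comap_lsmul [IsNoetherianRing A] (hE : E.FG) {z : A} (hz : IsSMulRegular L z) :
    (E.comap (LinearMap.lsmul A L z)).FG :=
  Submodule.fg_of_fg_map_injective (LinearMap.lsmul A L z) hz
    (hE.of_le (Submodule.map_comap_le _ _))

lemma fg_ker_lsmul_quotient [IsNoetherianRing A] (hE : E.FG) {z : A} (hz : IsSMulRegular L z) :
    (LinearMap.lsmul A (L ⧸ E) z).ker.FG := by
  have hcomap : (LinearMap.lsmul A (L ⧸ E) z).ker.comap E.mkQ =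
      E.comap (LinearMap.lsmul A L z) := by
    ext m
    exact Submodule.Quotient.mk_eq_zero E
  rw [← Submodule.map_comap_eq_of_surjective E.mkQ_surjective (LinearMap.ker _), hcomap]
  exact (fg_comap_lsmul hE hz).map E.mkQ

lemma finite_associatedPrimes_quotient [IsNoetherianRing A] (hE : E.FG) {u : A}
    (hu : IsSMulRegular L u) (hpow : ∀ m : L, ∃ n : ℕ, u ^ n • m ∈ E) :
    (associatedPrimes A (L ⧸ E)).Finite := by
  let K := (LinearMap.lsmul A (L ⧸ E) u).ker
  have : Module.Finite A K := Module.Finite.iff_fg.mpr (fg_ker_lsmul_quotient hE hu)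
  -- An associated prime contains a power of `u`, hence `u` itself, so it is associated to `K`.
  refine (associatedPrimes.finite A K).subset fun P hP => ?_
  obtain ⟨hPprime, m, rfl⟩ := isAssociatedPrime_iff.mp hP
  obtain ⟨m, rfl⟩ := E.mkQ_surjective m
  obtain ⟨n, hn⟩ := hpow m
  have hmem : u ∈ (⊥ : Submodule A (L ⧸ E)).colon {E.mkQ m} := by
    refine hPprime.mem_of_pow_mem n ?_
    rwa [Submodule.mem_colon_singleton, Submodule.mem_bot, ← map_smul, Submodule.mkQ_apply,
      Submodule.Quotient.mk_eq_zero]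
  rw [Submodule.mem_colon_singleton, Submodule.mem_bot] at hmem
  refine isAssociatedPrime_iff.mpr ⟨hPprime, ⟨E.mkQ m, hmem⟩, ?_⟩
  ext a
  simp only [Submodule.mem_colon_singleton, Submodule.mem_bot]
  exact Submodule.coe_eq_zero (x := a • (⟨E.mkQ m, hmem⟩ : K))

lemma generic_exists_pow_smul_mem [IsNoetherianRing A] (hE : E.FG)
    (hfin : (associatedPrimes A (L ⧸ E)).Finite) (T : Ideal A) :
    Generic T fun z => IsSMulRegular L z →
      ∃ k : ℕ, ∀ m : L, z • m ∈ E → ∀ t ∈ T ^ k, t • m ∈ E := by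
  refine ⟨{P ∈ associatedPrimes A (L ⧸ E) | ¬ T ≤ P}, hfin.subset (Set.sep_subset _ _),
    fun P hP => hP.2, fun z _ hz hreg => ?_⟩
  let K := (LinearMap.lsmul A (L ⧸ E) z).ker
  have : Module.Finite A K := Module.Finite.iff_fg.mpr (fg_ker_lsmul_quotient hE hreg)
  have hrad : T ≤ (Module.annihilator A K).radical := by
    rw [← Ideal.sInf_minimalPrimes]
    refine le_sInf fun P hP => ?_
    have hPK := Module.associatedPrimes.minimalPrimes_annihilator_subset_associatedPrimes A K hP
    by_contra hTP
    refine hz P ⟨associatedPrimes.subset_of_injective K.injective_subtype hPK, hTP⟩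
      (hPK.annihilator_le (Submodule.mem_annihilator.mpr ?_))
    exact fun m _ => Subtype.ext m.2
  obtain ⟨k, hk⟩ := Ideal.exists_pow_le_of_le_radical_of_fg hrad (IsNoetherian.noetherian T)
  refine ⟨k, fun m hm t ht => ?_⟩
  rw [← Submodule.Quotient.mk_eq_zero, Submodule.Quotient.mk_smul] at hm ⊢
  exact congrArg Subtype.val (Module.mem_annihilator.mp (hk ht) ⟨_, hm⟩)

end FilterRegular

section Rees

variable {R : Type*} [CommRing R] {I J : Ideal R} {F : Filtration I J}

variable (R) in
/-- The ring `R[t₁^{±1}, t₂^{±1}]` of Laurent polynomials, containing the extended Rees rings. -/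
abbrev Laurent : Type _ := AddMonoidAlgebra R (ℤ × ℤ)

lemma single_mem_extendedReesRing_iff {n : ℤ × ℤ} {c : R} :
    AddMonoidAlgebra.single n c ∈ extendedReesRing F ↔ c ∈ F.ideal n.1 n.2 := by
  classical
  refine ⟨fun h => by simpa using h n, fun h m => ?_⟩
  rw [AddMonoidAlgebra.coeff_single, Finsupp.single_apply]
  split_ifs with hm
  · exact hm ▸ h
  · exact Ideal.zero_mem _

lemma Filtration.ideal_eq_top (F : Filtration I J) {r s : ℤ} (hr : r ≤ 0) (hs : s ≤ 0) :
    F.ideal r s = ⊤ := by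
  refine top_le_iff.mp (le_trans ?_ (F.pow_le r s))
  simp [idealZPow, Int.toNat_of_nonpos hr, Int.toNat_of_nonpos hs]

lemma adicFiltration_ideal_one_zero (I J : Ideal R) : (adicFiltration I J).ideal 1 0 = I := by
  simp [adicFiltration, idealZPow]

lemma adicFiltration_ideal_succ {r : ℤ} (hr : 0 ≤ r) (s : ℤ) :
    (adicFiltration I J).ideal (r + 1) s = I * (adicFiltration I J).ideal r s := by
  simp only [adicFiltration, idealZPow, Int.toNat_add hr zero_le_one, Int.toNat_one, pow_succ']
  exact mul_assoc _ _ _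

lemma adicFiltration_ideal_le_idealZPow (r s : ℤ) :
    (adicFiltration I J).ideal r s ≤ idealZPow I r :=
  Ideal.mul_le_left

/-- The ideal of coefficients of the monomials of degree `n` in a submodule of the ring
of Laurent polynomials. -/
noncomputable def monomialIdeal (B : Submodule R (Laurent R)) (n : ℤ × ℤ) : Ideal R :=
  B.comap (AddMonoidAlgebra.lsingle n)

lemma mem_monomialIdeal {B : Submodule R (Laurent R)} {n : ℤ × ℤ} {c : R} :
    c ∈ monomialIdeal B n ↔ AddMonoidAlgebra.single n c ∈ B := Iff.rfl

section Subalgebra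

variable {B : Subalgebra R (Laurent R)} {K : Ideal R} {m : ℤ × ℤ}

lemma monomialIdeal_mul_le (B : Subalgebra R (Laurent R)) (m n : ℤ × ℤ) :
    monomialIdeal B.toSubmodule m * monomialIdeal B.toSubmodule n ≤
      monomialIdeal B.toSubmodule (m + n) := by
  rw [Ideal.mul_le]
  intro a ha b hb
  rw [mem_monomialIdeal, ← AddMonoidAlgebra.single_mul_single]
  exact B.mul_mem ha hb

lemma pow_le_monomialIdeal (h : K ≤ monomialIdeal B.toSubmodule m) (k : ℕ) :
    K ^ k ≤ monomialIdeal B.toSubmodule (k • m) := by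
  induction k with
  | zero => exact fun c _ => by simpa [mem_monomialIdeal] using B.algebraMap_mem c
  | succ k ih =>
    rw [pow_succ, succ_nsmul]
    exact (Ideal.mul_mono ih h).trans (monomialIdeal_mul_le B _ _)

lemma idealZPow_le_monomialIdeal (h : K ≤ monomialIdeal B.toSubmodule m)
    (h' : AddMonoidAlgebra.single (-m) (1 : R) ∈ B) (k : ℤ) :
    idealZPow K k ≤ monomialIdeal B.toSubmodule (k • m) := by
  obtain ⟨n, rfl | rfl⟩ := k.eq_nat_or_neg
  · simpa [idealZPow] using pow_le_monomialIdeal h n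
  · have htop : (⊤ : Ideal R) ≤ monomialIdeal B.toSubmodule (-m) :=
      top_le_iff.mpr ((Ideal.eq_top_iff_one _).mpr h')
    have hpow := pow_le_monomialIdeal htop n
    rw [Ideal.top_pow, smul_neg] at hpow
    rw [neg_smul, natCast_zsmul]
    exact le_top.trans hpow

lemma extendedReesRing_adic_le_of_le
    (hI : I ≤ monomialIdeal B.toSubmodule (1, 0)) (hJ : J ≤ monomialIdeal B.toSubmodule (0, 1))
    (h₁ : AddMonoidAlgebra.single (-1, 0) (1 : R) ∈ B)
    (h₂ : AddMonoidAlgebra.single (0, -1) (1 : R) ∈ B) :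
    extendedReesRing (adicFiltration I J) ≤ B := by
  intro f hf
  rw [← AddMonoidAlgebra.sum_coeff_single f]
  refine Subalgebra.sum_mem _ fun n _ => ?_
  have hle := (Ideal.mul_mono (idealZPow_le_monomialIdeal hI h₁ n.1)
    (idealZPow_le_monomialIdeal hJ h₂ n.2)).trans (monomialIdeal_mul_le B _ _)
  simpa using mem_monomialIdeal.mp (hle (hf n))

end Subalgebra

lemma fg_extendedReesRing_adic (hI : I.FG) (hJ : J.FG) :
    (extendedReesRing (adicFiltration I J)).FG := by
  classical
  obtain ⟨G, rfl⟩ := hI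
  obtain ⟨G', rfl⟩ := hJ
  let S : Finset (Laurent R) := G.image (AddMonoidAlgebra.single (1, 0)) ∪
    G'.image (AddMonoidAlgebra.single (0, 1)) ∪
    {AddMonoidAlgebra.single (-1, 0) 1, AddMonoidAlgebra.single (0, -1) 1}
  have hS {f : Laurent R} (hf : f ∈ S) : f ∈ Algebra.adjoin R (S : Set (Laurent R)) :=
    Algebra.subset_adjoin hf
  refine ⟨S, le_antisymm (Algebra.adjoin_le fun f hf => ?_) (extendedReesRing_adic_le_of_le
    (Ideal.span_le.mpr fun c hc => hS ?_) (Ideal.span_le.mpr fun c hc => hS ?_) (hS ?_) (hS ?_))⟩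
  · simp only [S, Finset.coe_union, Finset.coe_image, Finset.coe_insert, Finset.coe_singleton,
      Set.mem_union, Set.mem_image, Set.mem_insert_iff, Set.mem_singleton_iff] at hf
    obtain (⟨c, hc, rfl⟩ | ⟨c, hc, rfl⟩) | rfl | rfl := hf <;>
      refine single_mem_extendedReesRing_iff.mpr ?_
    · simpa [adicFiltration, idealZPow] using Ideal.subset_span hc
    · simpa [adicFiltration, idealZPow] using Ideal.subset_span hc
    all_goals simp [adicFiltration, idealZPow]
  all_goals simp only [S, Finset.mem_union, Finset.mem_image, Finset.mem_insert,
    Finset.mem_singleton]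
  · exact .inl (.inl ⟨c, hc, rfl⟩)
  · exact .inl (.inr ⟨c, hc, rfl⟩)
  · exact .inr (.inl trivial)
  · exact .inr (.inr trivial)

/-- The extended Rees ring of `{I ^ r J ^ s}`. -/
abbrev reesRing (I J : Ideal R) : Subalgebra R (Laurent R) :=
  extendedReesRing (adicFiltration I J)

instance [IsNoetherianRing R] : IsNoetherianRing (reesRing I J) :=
  have : Algebra.FiniteType R (reesRing I J) := (reesRing I J).fg_iff_finiteType.mp
    (fg_extendedReesRing_adic (IsNoetherian.noetherian I) (IsNoetherian.noetherian J))
  Algebra.FiniteType.isNoetherianRing R _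

/-- The extended Rees ring of `F` as a module over that of `{I ^ r J ^ s}`. -/
noncomputable def reesModule (F : Filtration I J) : Submodule (reesRing I J) (Laurent R) where
  carrier := extendedReesRing F
  add_mem' ha hb := (extendedReesRing F).add_mem ha hb
  zero_mem' := (extendedReesRing F).zero_mem
  smul_mem' c _ hx := (extendedReesRing F).mul_mem (extendedReesRing_adic_le F c.2) hx

lemma Filtration.IsAdmissible.reesModule_fg (hF : F.IsAdmissible) : (reesModule F).FG := by
  let := (Subalgebra.inclusion (extendedReesRing_adic_le F)).toRingHom.toAlgebra
  have : Module.Finite (reesRing I J) (extendedReesRing F) := hF.finite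
  let ψ : extendedReesRing F →ₗ[reesRing I J] (Laurent R) :=
    { toFun := Subtype.val
      map_add' := fun _ _ => rfl
      map_smul' := fun _ _ => rfl }
  have hrange : ψ.range = reesModule F := SetLike.coe_injective Subtype.range_val
  rw [← hrange, LinearMap.range_eq_map]
  exact (Module.finite_def.mp this).map ψ

lemma exists_forall_coeff_ne_zero_le (S : Finset (Laurent R)) :
    ∃ N : ℕ, ∀ f ∈ S, ∀ n, f.coeff n ≠ 0 → n ≤ ((N, N) : ℤ × ℤ) := by
  classical
  obtain ⟨b, hb⟩ := (S.biUnion fun f => f.coeff.support).bddAbove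
  refine ⟨max b.1.toNat b.2.toNat, fun f hf n hn => ?_⟩
  obtain ⟨h₁, h₂⟩ : n ≤ b := hb (Finset.mem_biUnion.mpr ⟨f, hf, Finsupp.mem_support_iff.mpr hn⟩)
  constructor <;> dsimp only <;> omega

lemma coeff_mul_mem {W : ℤ × ℤ → Ideal R} (hW : ∀ m n, F.ideal m.1 m.2 * W n ≤ W (m + n))
    {f g : Laurent R} (hf : f ∈ extendedReesRing F) (hg : ∀ n, g.coeff n ∈ W n) (n : ℤ × ℤ) :
    (f * g).coeff n ∈ W n := by
  classical
  rw [AddMonoidAlgebra.coeff_mul]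
  refine Ideal.sum_mem _ fun m _ => Ideal.sum_mem _ fun m' _ => ?_
  dsimp only
  split_ifs with h
  · exact h ▸ hW m m' (Ideal.mul_mem_mul (hf m) (hg m'))
  · exact Ideal.zero_mem _

lemma exists_monomialIdeal_le_iSup {C : Submodule (reesRing I J) (Laurent R)} (hC : C.FG)
    (hom : ∀ f ∈ C, ∀ n, AddMonoidAlgebra.single n (f.coeff n) ∈ C) :
    ∃ N : ℕ, ∀ n, monomialIdeal (C.restrictScalars R) n ≤ ⨆ m ≤ ((N, N) : ℤ × ℤ),
      (adicFiltration I J).ideal (n - m).1 (n - m).2 * monomialIdeal (C.restrictScalars R) m := by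
  obtain ⟨S, rfl⟩ := hC
  obtain ⟨N, hN⟩ := exists_forall_coeff_ne_zero_le S
  set C := Submodule.span (reesRing I J) (S : Set (Laurent R))
  let W (n : ℤ × ℤ) : Ideal R := ⨆ m ≤ ((N, N) : ℤ × ℤ),
    (adicFiltration I J).ideal (n - m).1 (n - m).2 * monomialIdeal (C.restrictScalars R) m
  have hW (m n : ℤ × ℤ) : (adicFiltration I J).ideal m.1 m.2 * W n ≤ W (m + n) := by
    simp only [W, Ideal.mul_iSup, ← mul_assoc, add_sub_assoc]
    exact iSup₂_mono fun p _ => Ideal.mul_mono_left ((adicFiltration I J).mul_le _ _ _ _)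
  suffices h : ∀ f ∈ C, ∀ n, f.coeff n ∈ W n by
    refine ⟨N, fun n x hx => ?_⟩
    have hcoeff := h _ hx n
    rwa [AddMonoidAlgebra.lsingle_apply, AddMonoidAlgebra.coeff_single,
      Finsupp.single_eq_same] at hcoeff
  intro f hf
  induction hf using Submodule.span_induction with
  | mem f hf =>
    intro n
    by_cases h0 : f.coeff n = 0
    · exact h0 ▸ Ideal.zero_mem _
    · refine Ideal.mem_iSup_of_mem n (Ideal.mem_iSup_of_mem (hN f hf n h0) ?_)
      have htop : (adicFiltration I J).ideal (n - n).1 (n - n).2 = ⊤ :=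
        Filtration.ideal_eq_top _ (by simp) (by simp)
      rw [htop, Ideal.top_mul]
      exact hom f (Submodule.subset_span hf) n
  | zero => exact fun n => Ideal.zero_mem _
  | add f g _ _ hf hg => exact fun n => Ideal.add_mem _ (hf n) (hg n)
  | smul a f _ hf => exact coeff_mul_mem hW a.2 hf

lemma Filtration.IsAdmissible.exists_le_idealZPow (hF : F.IsAdmissible) :
    ∃ N : ℕ, ∀ r s : ℤ, F.ideal r s ≤ idealZPow I (r - N) := by
  obtain ⟨N, hN⟩ := exists_monomialIdeal_le_iSup hF.reesModule_fg
    fun f hf n => single_mem_extendedReesRing_iff.mpr (hf n)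
  refine ⟨N, fun r s x hx => ?_⟩
  have hx' := hN (r, s) (single_mem_extendedReesRing_iff.mpr hx)
  refine (iSup₂_le fun m hm => ?_ : _ ≤ idealZPow I (r - N)) hx'
  exact Ideal.mul_le_left.trans ((adicFiltration_ideal_le_idealZPow _ _).trans
    (idealZPow_anti I (sub_le_sub_left hm.1 r)))

/-- The `R`-linear map from `I ^ r J ^ s` onto the homogeneous component of degree `n = (r, s)` of
the extended Rees ring. -/
noncomputable def reesMonomial (I J : Ideal R) (n : ℤ × ℤ) :
    (adicFiltration I J).ideal n.1 n.2 →ₗ[R] reesRing I J :=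
  (AddMonoidAlgebra.lsingle n ∘ₗ Submodule.subtype _).codRestrict (reesRing I J).toSubmodule
    fun c => single_mem_extendedReesRing_iff.mpr c.2

lemma coeff_reesMonomial_smul (n : ℤ × ℤ) (c : (adicFiltration I J).ideal n.1 n.2) (f : Laurent R)
    (m : ℤ × ℤ) : (reesMonomial I J n c • f).coeff (m + n) = c * f.coeff m := by
  change (AddMonoidAlgebra.single n c.1 * f).coeff _ = _
  rw [AddMonoidAlgebra.coeff_single_mul_apply, neg_add_eq_sub, add_sub_cancel_right]

lemma isSMulRegular_reesMonomial {n : ℤ × ℤ} {c : (adicFiltration I J).ideal n.1 n.2}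
    (hc : c.1 ∈ nonZeroDivisors R) : IsSMulRegular (Laurent R) (reesMonomial I J n c) :=
  fun f g hfg => by
    ext m
    have h := congrArg (fun f : Laurent R => f.coeff (m + n)) hfg
    simp only [coeff_reesMonomial_smul] at h
    exact (mul_cancel_left_mem_nonZeroDivisors hc).mp h

lemma reesMonomial_mem_span_pow {k : ℕ} {r : ℤ} (hr : k ≤ r) (s : ℤ)
    (c : (adicFiltration I J).ideal r s) :
    reesMonomial I J (r, s) c ∈ Ideal.span (Set.range (reesMonomial I J (1, 0))) ^ k := by
  induction k generalizing r with
  | zero => simp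
  | succ k ih =>
    obtain ⟨r, rfl⟩ : ∃ r', r = r' + 1 := ⟨r - 1, by ring⟩
    obtain ⟨c, hc⟩ := c
    have hc' : c ∈ I * (adicFiltration I J).ideal r s :=
      adicFiltration_ideal_succ (I := I) (J := J) (r := r) (by omega) s ▸ hc
    induction hc' using Submodule.mul_induction_on' with
    | mem_mul_mem a ha b hb =>
      have hmul : reesMonomial I J (r + 1, s) ⟨a * b, hc⟩ =
          reesMonomial I J (1, 0) ⟨a, (adicFiltration_ideal_one_zero I J).symm ▸ ha⟩ *
            reesMonomial I J (r, s) ⟨b, hb⟩ := by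
        refine Subtype.ext ?_
        change AddMonoidAlgebra.single (r + 1, s) (a * b) =
          AddMonoidAlgebra.single (1, 0) a * AddMonoidAlgebra.single (r, s) b
        rw [AddMonoidAlgebra.single_mul_single, Prod.mk_add_mk, zero_add, add_comm 1 r]
      rw [hmul, pow_succ']
      exact Ideal.mul_mem_mul (Ideal.subset_span ⟨_, rfl⟩) (ih (by omega) ⟨b, hb⟩)
    | add a ha b hb iha ihb =>
      rw [← adicFiltration_ideal_succ (by omega)] at ha hb
      exact (reesMonomial I J (r + 1, s)).map_add ⟨a, ha⟩ ⟨b, hb⟩ ▸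
        Ideal.add_mem _ (iha ha) (ihb hb)

lemma finite_associatedPrimes_quotient_reesModule [IsNoetherianRing R] (hF : F.IsAdmissible) :
    (associatedPrimes (reesRing I J) (Laurent R ⧸ reesModule F)).Finite := by
  let one : (adicFiltration I J).ideal (-1, -1).1 (-1, -1).2 :=
    ⟨1, by simp [Filtration.ideal_eq_top]⟩
  let u : reesRing I J := reesMonomial I J (-1, -1) one
  have hu : IsSMulRegular (Laurent R) u := isSMulRegular_reesMonomial (one_mem _)
  refine finite_associatedPrimes_quotient hF.reesModule_fg hu fun f => ?_
  have hcoeff (n : ℕ) (f : Laurent R) (m : ℤ × ℤ) :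
      (u ^ n • f).coeff (m + n • (-1, -1)) = f.coeff m := by
    induction n generalizing f with
    | zero => simp
    | succ n ih =>
      rw [pow_succ', mul_smul, succ_nsmul, ← add_assoc, coeff_reesMonomial_smul, ih]
      exact one_mul _
  obtain ⟨N, hN⟩ := exists_forall_coeff_ne_zero_le {f}
  refine ⟨N, fun m => ?_⟩
  obtain ⟨m, rfl⟩ : ∃ m', m = m' + N • (-1, -1) := ⟨m - N • (-1, -1), (sub_add_cancel _ _).symm⟩
  rw [hcoeff]
  by_cases h0 : f.coeff m = 0
  · exact h0 ▸ Ideal.zero_mem _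
  · obtain ⟨h₁, h₂⟩ := hN f (Finset.mem_singleton_self f) _ h0
    rw [F.ideal_eq_top (by simpa using h₁) (by simpa using h₂)]
    trivial

theorem Filtration.IsAdmissible.generic_superficial [IsNoetherianRing R] (hF : F.IsAdmissible) :
    Generic I fun a => a ∈ nonZeroDivisors R →
      ∃ N : ℕ, ∀ r s : ℤ, N ≤ r → ∀ x, a * x ∈ F.ideal (r + 1) s → x ∈ F.ideal r s := by
  have hgen := (generic_exists_pow_smul_mem hF.reesModule_fg
    (finite_associatedPrimes_quotient_reesModule hF) _).comap (reesMonomial I J (1, 0))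
  suffices h : Generic ((adicFiltration I J).ideal 1 0) _ by
    rwa [adicFiltration_ideal_one_zero] at h
  refine hgen.mono fun a ha hkill hreg => ?_
  let z : reesRing I J := reesMonomial I J (1, 0) ⟨a, ha⟩
  have hz : IsSMulRegular (Laurent R) z := isSMulRegular_reesMonomial hreg
  obtain ⟨k, hk⟩ := hkill ha hz
  let C := (reesModule F).comap (LinearMap.lsmul (reesRing I J) (Laurent R) z)
  have hmem {r s : ℤ} {x : R} :
      AddMonoidAlgebra.single (r, s) x ∈ C ↔ a * x ∈ F.ideal (r + 1) s := by
    change AddMonoidAlgebra.single (1, 0) a * _ ∈ extendedReesRing F ↔ _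
    rw [AddMonoidAlgebra.single_mul_single, Prod.mk_add_mk, zero_add, add_comm,
      single_mem_extendedReesRing_iff]
  have hom : ∀ f ∈ C, ∀ n, AddMonoidAlgebra.single n (f.coeff n) ∈ C := fun f hf n => by
    have h : (z • f).coeff (n + (1, 0)) ∈ F.ideal (n.1 + 1) (n.2 + 0) := hf (n + (1, 0))
    rw [coeff_reesMonomial_smul, add_zero] at h
    exact hmem.mpr h
  obtain ⟨N, hN⟩ := exists_monomialIdeal_le_iSup (fg_comap_lsmul hF.reesModule_fg hz) hom
  refine ⟨N + k, fun r s hr x hx => (iSup₂_le fun m hm => ?_ : _ ≤ F.ideal r s)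
    (hN (r, s) (hmem.mpr hx))⟩
  refine Ideal.mul_le.mpr fun c hc y hy => ?_
  have hkm : k ≤ r - m.1 := by
    have hmN : m.1 ≤ N := hm.1
    omega
  have ht := reesMonomial_mem_span_pow hkm _ ⟨c, hc⟩
  have hcy := hk _ hy _ ht
  change AddMonoidAlgebra.single ((r, s) - m) c * AddMonoidAlgebra.single m y ∈
    extendedReesRing F at hcy
  rwa [AddMonoidAlgebra.single_mul_single, sub_add_cancel, single_mem_extendedReesRing_iff] at hcy

end Rees

section Transfer

variable {R S : Type*} [CommRing R] [CommRing S] {I J : Ideal R}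

lemma finite_inclusion_of_ringHom {I' J' : Ideal S} {F : Filtration I J} {F' : Filtration I' J'}
    (φ : AddMonoidAlgebra R (ℤ × ℤ) →+* AddMonoidAlgebra S (ℤ × ℤ))
    (hA : ∀ f ∈ reesRing I J, φ f ∈ reesRing I' J')
    (hE : ∀ f ∈ extendedReesRing F, φ f ∈ extendedReesRing F')
    (hsurj : ∀ g ∈ extendedReesRing F', ∃ f ∈ extendedReesRing F, φ f = g)
    (hF : (Subalgebra.inclusion (extendedReesRing_adic_le F)).Finite) :
    (Subalgebra.inclusion (extendedReesRing_adic_le F')).Finite := by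
  let φA : reesRing I J →+* reesRing I' J' := φ.restrict _ _ hA
  let φE : extendedReesRing F →+* extendedReesRing F' := φ.restrict _ _ hE
  have hφE : φE.Finite := .of_surjective φE fun g => by
    obtain ⟨f, hf, hfg⟩ := hsurj g g.2
    exact ⟨⟨f, hf⟩, Subtype.ext hfg⟩
  have hcomp := hφE.comp hF
  exact RingHom.Finite.of_comp_finite (f := φA)
    (g := (Subalgebra.inclusion (extendedReesRing_adic_le F')).toRingHom) hcomp

/-- The filtration with the roles of `I` and `J` exchanged. -/
def Filtration.swap (F : Filtration I J) : Filtration J I where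
  ideal r s := F.ideal s r
  pow_le r s := (mul_comm _ _).trans_le (F.pow_le s r)
  mul_le r s r' s' := F.mul_le s r s' r'
  anti r s r' s' hr hs := F.anti s r s' r' hs hr

lemma Filtration.IsAdmissible.swap {F : Filtration I J} (hF : F.IsAdmissible) :
    F.swap.IsAdmissible where
  eq_posPart r s := hF.eq_posPart s r
  finite := by
    let φ := AddMonoidAlgebra.domCongr R R (AddEquiv.prodComm (M := ℤ) (N := ℤ))
    have hcoeff (f : AddMonoidAlgebra R (ℤ × ℤ)) (n : ℤ × ℤ) :
        (φ f).coeff n = f.coeff n.swap := AddMonoidAlgebra.coeff_domCongr ..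
    refine finite_inclusion_of_ringHom (φ : _ →+* _) (fun f hf n => ?_) (fun f hf n => ?_)
      (fun g hg => ⟨φ.symm g, fun n => ?_, φ.apply_symm_apply g⟩) hF.finite
    · exact hcoeff f n ▸ (mul_comm (idealZPow I _) (idealZPow J _)).le (hf n.swap)
    · exact hcoeff f n ▸ hf n.swap
    · have := hcoeff (φ.symm g) n.swap
      rw [φ.apply_symm_apply, Prod.swap_swap] at this
      exact this ▸ hg n.swap

lemma idealZPow_map (f : R →+* S) (n : ℤ) :
    idealZPow (I.map f) n = (idealZPow I n).map f :=
  (Ideal.map_pow f I _).symm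

/-- The image of a filtration under a ring homomorphism. -/
def Filtration.map (F : Filtration I J) (f : R →+* S) : Filtration (I.map f) (J.map f) where
  ideal r s := (F.ideal r s).map f
  pow_le r s := by
    rw [idealZPow_map, idealZPow_map, ← Ideal.map_mul]
    exact Ideal.map_mono (F.pow_le r s)
  mul_le r s r' s' := by
    rw [← Ideal.map_mul]
    exact Ideal.map_mono (F.mul_le r s r' s')
  anti r s r' s' hr hs := Ideal.map_mono (F.anti r s r' s' hr hs)

lemma Filtration.IsAdmissible.map {F : Filtration I J} (hF : F.IsAdmissible) {f : R →+* S}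
    (hf : Function.Surjective f) : (F.map f).IsAdmissible where
  eq_posPart r s := congrArg (Ideal.map f) (hF.eq_posPart r s)
  finite := by
    refine finite_inclusion_of_ringHom (AddMonoidAlgebra.mapRingHom (ℤ × ℤ) f) (fun g hg n => ?_)
      (fun g hg n => ?_) (fun g hg => ?_) hF.finite
    · rw [AddMonoidAlgebra.coeff_mapRingHom]
      simpa only [adicFiltration, idealZPow_map, Ideal.map_mul] using
        Ideal.mem_map_of_mem f (hg n)
    · rw [AddMonoidAlgebra.coeff_mapRingHom]
      exact Ideal.mem_map_of_mem f (hg n)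
    · have hex (n : ℤ × ℤ) : ∃ c ∈ F.ideal n.1 n.2, f c = g.coeff n :=
        (Ideal.mem_map_iff_of_surjective f hf).mp (hg n)
      choose c hc hcg using hex
      refine ⟨∑ n ∈ g.coeff.support, AddMonoidAlgebra.single n (c n),
        Subalgebra.sum_mem _ fun n _ => single_mem_extendedReesRing_iff.mpr (hc n), ?_⟩
      conv_rhs => rw [← AddMonoidAlgebra.sum_coeff_single g]
      simp only [map_sum, AddMonoidAlgebra.mapRingHom_single, hcg]
      rfl

end Transfer

section DimensionOne

variable {R : Type*} [CommRing R] {I J : Ideal R} {F : Filtration I J} {a : R}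

lemma Filtration.hilbertFunction_zero_zero (F : Filtration I J) : F.hilbertFunction 0 0 = 0 := by
  change colength (F.ideal 0 0) = 0
  rw [F.ideal_eq_top le_rfl le_rfl, colength_top]

lemma Filtration.le_ideal_one_zero (F : Filtration I J) : I ≤ F.ideal 1 0 := by
  simpa [idealZPow] using F.pow_le 1 0

lemma Filtration.span_mul_le (F : Filtration I J) (ha : a ∈ I) (r s : ℤ) :
    Ideal.span {a} * F.ideal r s ≤ F.ideal (r + 1) s := by
  have h : Ideal.span {a} ≤ F.ideal 1 0 :=
    (Ideal.span_singleton_le_iff_mem _).mpr (F.le_ideal_one_zero ha)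
  simpa [add_comm] using (Ideal.mul_mono_left h).trans (F.mul_le 1 0 r s)

lemma colon_span_mul (ha : a ∈ nonZeroDivisors R) (K : Ideal R) :
    (Ideal.span {a} * K).colon {a} = K := by
  ext x
  rw [Submodule.mem_colon_singleton, smul_eq_mul, mul_comm x, Ideal.mem_span_singleton_mul]
  simp [mul_cancel_left_mem_nonZeroDivisors ha]

lemma Filtration.IsAdmissible.ideal_eq_idealZPow_of_nat (hF : F.IsAdmissible)
    (h : ∀ r s : ℕ, F.ideal r s = I ^ r * J ^ s) (r s : ℤ) :
    F.ideal r s = idealZPow I r * idealZPow J s := by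
  rw [hF.eq_posPart, ← Int.toNat_eq_max, ← Int.toNat_eq_max, h]
  rfl

variable [IsLocalRing R]

lemma Filtration.containsMaxPow [IsNoetherianRing R] (F : Filtration I J)
    (hI : IsMaximalPrimary I) (hJ : IsMaximalPrimary J) (r s : ℤ) :
    ContainsMaxPow (F.ideal r s) :=
  ((hI.containsMaxPow.pow _).mul (hJ.containsMaxPow.pow _)).mono (F.pow_le r s)

variable [IsNoetherianRing R]

lemma colength_span_mul (ha : a ∈ nonZeroDivisors R) {K : Ideal R}
    (h : ContainsMaxPow (Ideal.span {a})) (hK : ContainsMaxPow K) :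
    colength (Ideal.span {a} * K) = colength K + colength (Ideal.span {a}) := by
  rw [(h.mul hK).colength_eq_add a, colon_span_mul ha, sup_eq_right.mpr Ideal.mul_le_left]

variable [Infinite (ResidueField R)]

lemma Filtration.IsAdmissible.exists_reduction (hF : F.IsAdmissible)
    (hd : ringKrullDim R ≤ 1) (h0 : DepthPos (⊥ : Ideal R)) (hI : IsMaximalPrimary I) :
    ∃ a ∈ I, a ∈ nonZeroDivisors R ∧ ∃ N : ℕ, ∀ r s : ℤ, N ≤ r →
      F.ideal (r + 1) s = Ideal.span {a} * F.ideal r s := by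
  obtain ⟨a, haI, ha, hsup⟩ :=
    ((generic_mem_nonZeroDivisors h0 hI).and hF.generic_superficial).exists
  obtain ⟨N, hN⟩ := hsup ha
  obtain ⟨N', hN'⟩ := hF.exists_le_idealZPow
  obtain ⟨k, hk⟩ := containsMaxPow_span_singleton hd ha
  refine ⟨a, haI, ha, N + N' + k, fun r s hr => le_antisymm (fun x hx => ?_)
    (F.span_mul_le haI r s)⟩
  push_cast at hr
  have hxa : x ∈ Ideal.span {a} :=
    hk (Ideal.pow_le_pow_right (by omega)
      (Ideal.pow_right_mono hI.le_maximalIdeal _ (hN' _ _ hx)))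
  obtain ⟨y, rfl⟩ := Ideal.mem_span_singleton.mp hxa
  exact Ideal.mem_span_singleton_mul.mpr ⟨y, hN r s (by omega) y hx, rfl⟩

variable (hF : F.IsAdmissible) (hd : ringKrullDim R ≤ 1) (h0 : DepthPos (⊥ : Ideal R))
  (hI : IsMaximalPrimary I) (hJ : IsMaximalPrimary J)
include hF hd h0 hI hJ

namespace Filtration.IsAdmissible

lemma exists_hasBinomialCoeff_sub_left : ∃ a ∈ I, a ∈ nonZeroDivisors R ∧
    HasBinomialCoeff (fun r s => F.hilbertFunction r s - F.hilbertFunction (r - 1) s) 0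
      (Pi.single 0 (colength (Ideal.span {a}))) := by
  obtain ⟨a, haI, ha, N, hN⟩ := hF.exists_reduction hd h0 hI
  refine ⟨a, haI, ha, hasBinomialCoeff_zero (N := N + 1) fun r s hr _ => ?_⟩
  have hred := hN (r - 1) s (by omega)
  rw [sub_add_cancel] at hred
  rw [sub_eq_iff_eq_add']
  change colength (F.ideal r s) = _
  rw [hred]
  exact colength_span_mul ha (containsMaxPow_span_singleton hd ha) (F.containsMaxPow hI hJ _ _)

lemma exists_isHilbertCoeff_one : ∃ e, F.IsHilbertCoeff 1 e := by
  obtain ⟨_, _, _, hl⟩ := hF.exists_hasBinomialCoeff_sub_left hd h0 hI hJ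
  obtain ⟨_, _, _, hr⟩ := hF.swap.exists_hasBinomialCoeff_sub_left hd h0 hJ hI
  exact HasBinomialCoeff.exists_succ hl hr.swap

lemma exists_colength_span_eq {e : ℕ × ℕ → ℤ} (he : F.IsHilbertCoeff 1 e) :
    ∃ a ∈ I, a ∈ nonZeroDivisors R ∧ colength (Ideal.span {a}) = e (1, 0) := by
  obtain ⟨a, haI, ha, hl⟩ := hF.exists_hasBinomialCoeff_sub_left hd h0 hI hJ
  exact ⟨a, haI, ha, by simpa using congrFun (hl.unique (HasBinomialCoeff.sub_left he)) 0⟩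

lemma hilbertFunction_succ_le {e : ℕ × ℕ → ℤ} (he : F.IsHilbertCoeff 1 e) (r s : ℤ) :
    F.hilbertFunction (r + 1) s ≤ F.hilbertFunction r s + e (1, 0) := by
  obtain ⟨a, haI, ha, hae⟩ := hF.exists_colength_span_eq hd h0 hI hJ he
  have hac := containsMaxPow_span_singleton hd ha
  have hK := F.containsMaxPow hI hJ r s
  rw [← hae]
  exact ((hac.mul hK).colength_le (F.span_mul_le haI r s)).trans (colength_span_mul ha hac hK).le

lemma hilbertFunction_eq_binomialPolynomial_one {e : ℕ × ℕ → ℤ} (he : F.IsHilbertCoeff 1 e)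
    (he0 : e 0 = 0) {r s : ℤ} (hr : 0 ≤ r) (hs : 0 ≤ s) :
    F.hilbertFunction r s = binomialPolynomial 1 e r s := by
  -- The defect is monotone in both variables and vanishes both at the origin and far out.
  let g (r s : ℤ) : ℤ := binomialPolynomial 1 e r s - F.hilbertFunction r s
  have hgr (s : ℤ) : Monotone fun r => g r s := monotone_int_of_le_succ fun r => by
    have := hF.hilbertFunction_succ_le hd h0 hI hJ he r s
    simp only [g, binomialPolynomial_one]
    linarith
  have hgs (r : ℤ) : Monotone (g r) := monotone_int_of_le_succ fun s => by
    have : F.hilbertFunction r (s + 1) ≤ F.hilbertFunction r s + e (0, 1) :=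
      hF.swap.hilbertFunction_succ_le hd h0 hJ hI (HasBinomialCoeff.swap he) s r
    simp only [g, binomialPolynomial_one]
    linarith
  obtain ⟨N, hN⟩ := he.2
  have hlower : g 0 0 ≤ g r s := (hgr 0 hr).trans (hgs r hs)
  have hupper : g r s ≤ g (max r N) (max s N) :=
    (hgr s (le_max_left r N)).trans (hgs _ (le_max_left s N))
  have hzero : g 0 0 = 0 := by
    simp [g, binomialPolynomial_zero_zero, he0, F.hilbertFunction_zero_zero]
  have hfar : g (max r N) (max s N) = 0 :=
    sub_eq_zero.mpr (hN _ _ (le_max_right r N) (le_max_right s N)).symm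
  linarith

lemma exists_eq_span_and_ideal_succ {e : ℕ × ℕ → ℤ} (he : F.IsHilbertCoeff 1 e)
    (he0 : e 0 = 0) : ∃ a, I = Ideal.span {a} ∧
      ∀ r s : ℕ, F.ideal (r + 1 : ℕ) s = I * F.ideal r s := by
  obtain ⟨a, haI, ha, hae⟩ := hF.exists_colength_span_eq hd h0 hI hJ he
  have hac := containsMaxPow_span_singleton hd ha
  have hspan (r s : ℕ) : Ideal.span {a} * F.ideal r s = F.ideal (r + 1 : ℕ) s := by
    have hK := F.containsMaxPow hI hJ r s
    refine (hac.mul hK).eq_of_colength_le (by exact_mod_cast F.span_mul_le haI r s) ?_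
    have heq {r s : ℤ} := hF.hilbertFunction_eq_binomialPolynomial_one hd h0 hI hJ he he0
      (r := r) (s := s)
    have h : F.hilbertFunction (r + 1 : ℕ) s = F.hilbertFunction r s + e (1, 0) := by
      rw [heq (by positivity) (by positivity), heq (by positivity) (by positivity),
        binomialPolynomial_one, binomialPolynomial_one]
      push_cast
      ring
    rw [colength_span_mul ha hac hK, hae]
    exact h.ge
  have hIa : I = Ideal.span {a} := by
    refine le_antisymm ?_ ((Ideal.span_singleton_le_iff_mem I).mpr haI)
    have := hspan 0 0
    rw [Nat.cast_zero, F.ideal_eq_top le_rfl le_rfl, Ideal.mul_top] at this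
    exact this ▸ F.le_ideal_one_zero
  exact ⟨a, hIa, fun r s => by rw [← hspan, ← hIa]⟩

lemma exists_eq_span_left {e : ℕ × ℕ → ℤ} (he : F.IsHilbertCoeff 1 e) (he0 : e 0 = 0) :
    ∃ a, I = Ideal.span {a} :=
  (hF.exists_eq_span_and_ideal_succ hd h0 hI hJ he he0).imp fun _ => And.left

lemma exists_eq_span_right {e : ℕ × ℕ → ℤ} (he : F.IsHilbertCoeff 1 e) (he0 : e 0 = 0) :
    ∃ b, J = Ideal.span {b} :=
  hF.swap.exists_eq_span_left hd h0 hJ hI (HasBinomialCoeff.swap he) he0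

lemma ideal_eq_of_dim_one {e : ℕ × ℕ → ℤ} (he : F.IsHilbertCoeff 1 e) (he0 : e 0 = 0) (r s : ℤ) :
    F.ideal r s = idealZPow I r * idealZPow J s := by
  obtain ⟨_, _, hl⟩ := hF.exists_eq_span_and_ideal_succ hd h0 hI hJ he he0
  obtain ⟨_, _, hr⟩ :=
    hF.swap.exists_eq_span_and_ideal_succ hd h0 hJ hI (HasBinomialCoeff.swap he) he0
  refine hF.ideal_eq_idealZPow_of_nat (fun r s => ?_) r s
  induction r with
  | zero =>
    induction s with
    | zero => simp [F.ideal_eq_top]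
    | succ s ih =>
      rw [show F.ideal (0 : ℕ) (s + 1 : ℕ) = J * F.ideal (0 : ℕ) s from hr s 0, ih]
      ring
  | succ r ih =>
    rw [hl, ih]
    ring

end Filtration.IsAdmissible

end DimensionOne

section GeneralPosition

variable {R : Type*} [CommRing R] {I K : Ideal R} {a c : R}

/-- The ideal `(a, c)` contains `I`, and `a` is a nonzerodivisor modulo `c`. -/
structure RegularPair (I : Ideal R) (a c : R) : Prop where
  le_sup : I ≤ Ideal.span {a} ⊔ Ideal.span {c}
  mem_span_of_mul_mem : ∀ z, a * z ∈ Ideal.span {c} → z ∈ Ideal.span {c}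

lemma RegularPair.mem_of_mul_mem (h : RegularPair I a c) {z : R}
    (hz : a * z ∈ I * K ⊔ Ideal.span {c}) : z ∈ K ⊔ Ideal.span {c} := by
  have hle : I * K ⊔ Ideal.span {c} ≤ Ideal.span {a} * K ⊔ Ideal.span {c} := by
    refine sup_le ((Ideal.mul_mono_left h.le_sup).trans ?_) le_sup_right
    rw [Ideal.sup_mul]
    exact sup_le_sup_left Ideal.mul_le_left _
  obtain ⟨_, hy, t, ht, hyt⟩ := Submodule.mem_sup.mp (hle hz)
  obtain ⟨k, hk, rfl⟩ := Ideal.mem_span_singleton_mul.mp hy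
  have hzk : z - k ∈ Ideal.span {c} := by
    refine h.mem_span_of_mul_mem _ ?_
    rwa [mul_sub, ← hyt, add_sub_cancel_left]
  exact Submodule.mem_sup.mpr ⟨k, hk, z - k, hzk, add_sub_cancel k z⟩

/-- The elements of the list `as` lie in `I`, and each of them is regular, in the sense of
`RegularPair I`, modulo each of its successors and modulo each element of `cs`. -/
def InGeneralPosition (I : Ideal R) : List R → List R → Prop
  | [], _ => True
  | a :: as, cs => a ∈ I ∧ (∀ c ∈ as ++ cs, RegularPair I a c) ∧ InGeneralPosition I as cs

namespace InGeneralPosition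

variable {as cs : List R}

lemma mem_pow_mul (h : InGeneralPosition I as cs)
    (hK : ∀ g, (∀ c ∈ cs, g ∈ K ⊔ Ideal.span {c}) → g ∈ K) {f : R}
    (hf : ∀ c ∈ as ++ cs, f ∈ I ^ as.length * K ⊔ Ideal.span {c}) : f ∈ I ^ as.length * K := by
  induction as generalizing f with
  | nil => simpa using hK f (by simpa using hf)
  | cons a as ih =>
    obtain ⟨haI, hpair, has⟩ := h
    rw [List.cons_append, List.forall_mem_cons] at hf
    simp only [List.length_cons, pow_succ', mul_assoc] at hf ⊢
    obtain ⟨k, hk, _, hag, rfl⟩ := Submodule.mem_sup.mp hf.1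
    obtain ⟨g, rfl⟩ := Ideal.mem_span_singleton.mp hag
    have hg : g ∈ I ^ as.length * K := ih has fun c hc => by
      refine (hpair c hc).mem_of_mul_mem ?_
      simpa using Ideal.sub_mem _ (hf.2 c hc) (Ideal.mem_sup_left hk)
    exact Ideal.add_mem _ hk (Ideal.mul_mem_mul haI hg)

lemma mem_pow (h : InGeneralPosition I as []) {f : R}
    (hf : ∀ a ∈ as, f ∈ I ^ as.length ⊔ Ideal.span {a}) : f ∈ I ^ as.length := by
  simpa using h.mem_pow_mul (K := ⊤) (by simp) (by simpa using hf)

lemma colon_pow_mul (h : InGeneralPosition I (a :: as) cs)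
    (hK : ∀ g, (∀ c ∈ cs, g ∈ K ⊔ Ideal.span {c}) → g ∈ K) :
    (I ^ (as.length + 1) * K).colon {a} = I ^ as.length * K := by
  obtain ⟨haI, hpair, has⟩ := h
  ext x
  rw [Submodule.mem_colon_singleton, smul_eq_mul, mul_comm x, pow_succ', mul_assoc]
  exact ⟨fun hx => has.mem_pow_mul hK fun c hc =>
    (hpair c hc).mem_of_mul_mem (Ideal.mem_sup_left hx), Ideal.mul_mem_mul haI⟩

end InGeneralPosition

lemma le_span_singleton_sup_of_isUnit {x p z : R} (hx : I ≤ Ideal.span {x} ⊔ K) (hp : IsUnit p)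
    (hz : z ∈ K) : I ≤ Ideal.span {p * x + z} ⊔ K := by
  refine hx.trans (sup_le ?_ le_sup_right)
  rw [Ideal.span_singleton_le_iff_mem, ← Ideal.unit_mul_mem_iff_mem _ hp]
  exact Ideal.mem_span_singleton_sup.mpr ⟨1, -z, Ideal.neg_mem_iff K |>.mpr hz, by ring⟩

variable [IsLocalRing R]

lemma exists_inGeneralPosition [Infinite (ResidueField R)] {p : R → Prop} (hp : Generic I p)
    (h : ∀ c ∈ I, p c → Generic I (RegularPair I · c)) {cs : List R}
    (hcs : ∀ c ∈ cs, Generic I (RegularPair I · c)) (n : ℕ) :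
    ∃ as : List R, as.length = n ∧ (∀ a ∈ as, a ∈ I ∧ p a) ∧ InGeneralPosition I as cs := by
  induction n with
  | zero => exact ⟨[], rfl, by simp, trivial⟩
  | succ n ih =>
    obtain ⟨as, rfl, hIp, has⟩ := ih
    have hgen : ∀ c ∈ as ++ cs, Generic I (RegularPair I · c) := List.forall_mem_append.mpr
      ⟨fun c hc => h c (hIp c hc).1 (hIp c hc).2, hcs⟩
    obtain ⟨a, haI, hpa, hpair⟩ := (hp.and (generic_forall_list _ hgen)).exists
    exact ⟨a :: as, rfl, List.forall_mem_cons.mpr ⟨⟨haI, hpa⟩, hIp⟩, haI, hpair, has⟩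

variable [IsNoetherianRing R]

lemma DepthPos.not_le_sup_maximalIdeal_mul (h : DepthPos K) (hK : K ≠ ⊤) (hI : ContainsMaxPow I) :
    ¬ I ≤ K ⊔ maximalIdeal R * I := fun hle =>
  h.not_containsMaxPow hK <| hI.mono <|
    Submodule.le_of_le_smul_of_le_jacobson_bot (IsNoetherian.noetherian I)
      (maximalIdeal_le_jacobson _) hle

lemma generic_regularPair (hI : ContainsMaxPow I) (hcm : c ∈ maximalIdeal R)
    (hc : DepthPos (Ideal.span {c})) (hx : ∃ x ∈ I, I ≤ Ideal.span {x} ⊔ Ideal.span {c}) :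
    Generic I (RegularPair I · c) := by
  obtain ⟨x, hxI, hx⟩ := hx
  have hctop : Ideal.span {c} ≠ ⊤ := by rwa [Ne, Ideal.span_singleton_eq_top]
  refine (generic_notMem (hc.not_le_sup_maximalIdeal_mul hctop hI)).mono fun a haI ha => ?_
  have hle : I ≤ Ideal.span {a} ⊔ Ideal.span {c} := by
    obtain ⟨p, z, hz, rfl⟩ := Ideal.mem_span_singleton_sup.mp (hx haI)
    refine le_span_singleton_sup_of_isUnit hx ?_ hz
    contrapose! ha
    exact add_comm z _ ▸ Submodule.add_mem_sup hz (Ideal.mul_mem_mul ha hxI)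
  exact ⟨hle, fun z hz => hc.mem_of_mul_mem (hI.mono hle) hz⟩

end GeneralPosition

section DimensionTwo

variable {R : Type*} [CommRing R] {I J : Ideal R} {F : Filtration I J} {a : R} {e : ℕ × ℕ → ℤ}

/-- Modulo `a`, the ideals `I` and `J` are principal and `F` is the filtration `{I^r J^s}`, whose
Hilbert function is the polynomial of degree at most one with coefficients `e`. -/
structure Filtration.IsAdicModulo (F : Filtration I J) (e : ℕ × ℕ → ℤ) (a : R) : Prop where
  exists_left : ∃ x ∈ I, I ≤ Ideal.span {x} ⊔ Ideal.span {a}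
  exists_right : ∃ y ∈ J, J ≤ Ideal.span {y} ⊔ Ideal.span {a}
  ideal_sup_eq : ∀ r s : ℕ, F.ideal r s ⊔ Ideal.span {a} = I ^ r * J ^ s ⊔ Ideal.span {a}
  colength_eq : ∀ r s : ℕ, colength (F.ideal r s ⊔ Ideal.span {a}) = binomialPolynomial 1 e r s

lemma exists_le_span_sup_of_map_eq_span {L : Ideal R} {x : R ⧸ L}
    (h : I.map (Ideal.Quotient.mk L) = Ideal.span {x}) : ∃ x ∈ I, I ≤ Ideal.span {x} ⊔ L := by
  obtain ⟨x, hx, rfl⟩ := (Ideal.mem_map_iff_of_surjective _ Ideal.Quotient.mk_surjective).mp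
    (h ▸ Ideal.mem_span_singleton_self x)
  refine ⟨x, hx, ?_⟩
  rw [← Set.image_singleton, ← Ideal.map_span] at h
  have := Ideal.le_comap_of_map_le h.le
  rwa [Ideal.comap_map_quotientMk, sup_comm] at this

variable [IsLocalRing R]

lemma isLocalRing_quotient_span_singleton (ha : a ∈ maximalIdeal R) :
    IsLocalRing (R ⧸ Ideal.span {a}) := by
  have : Nontrivial (R ⧸ Ideal.span {a}) := by
    rwa [Ideal.Quotient.nontrivial_iff, Ne, Ideal.span_singleton_eq_top]
  exact .of_surjective' _ Ideal.Quotient.mk_surjective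

lemma Filtration.hilbertFunction_sub_eq [IsNoetherianRing R] (F : Filtration I J)
    (hI : IsMaximalPrimary I) (hJ : IsMaximalPrimary J) (ha : a ∈ I) {r s : ℤ}
    (h : ∀ x, a * x ∈ F.ideal (r + 1) s → x ∈ F.ideal r s) :
    F.hilbertFunction (r + 1) s - F.hilbertFunction r s =
      (F.map (Ideal.Quotient.mk (Ideal.span {a}))).hilbertFunction (r + 1) s := by
  have hcolon : (F.ideal (r + 1) s).colon {a} = F.ideal r s := by
    ext x
    rw [Submodule.mem_colon_singleton, smul_eq_mul, mul_comm]
    exact ⟨h x, fun hx => F.span_mul_le ha r s (Ideal.mem_span_singleton_mul.mpr ⟨x, hx, rfl⟩)⟩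
  rw [sub_eq_iff_eq_add']
  change colength _ = colength _ + colength ((F.ideal (r + 1) s).map _)
  rw [colength_map_quotient, ← hcolon]
  exact (F.containsMaxPow hI hJ (r + 1) s).colength_eq_add a

variable (hF : F.IsAdmissible) (hCM : IsCohenMacaulayLocal R)
  (hd : ringKrullDim R = ((2 : ℕ∞) : WithBot ℕ∞)) (hI : IsMaximalPrimary I)
  (hJ : IsMaximalPrimary J)
include hF hCM hd hI hJ

namespace Filtration.IsAdmissible

lemma generic_hilbertFunction_sub_eq : Generic I fun a => a ∈ nonZeroDivisors R ∧
    ∃ N : ℤ, ∀ r s, N ≤ r → F.hilbertFunction r s - F.hilbertFunction (r - 1) s =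
      (F.map (Ideal.Quotient.mk (Ideal.span {a}))).hilbertFunction r s := by
  have := hCM.1
  refine ((generic_mem_nonZeroDivisors (hCM.depthPos_bot hd one_le_two) hI).and
    hF.generic_superficial).mono fun a haI ⟨ha, hsup⟩ => ⟨ha, ?_⟩
  obtain ⟨N, hN⟩ := hsup ha
  refine ⟨N + 1, fun r s hr => ?_⟩
  simpa using F.hilbertFunction_sub_eq hI hJ haI (hN (r - 1) s (by omega))

variable [Infinite (ResidueField R)]

lemma exists_isHilbertCoeff_map_quotient (haI : a ∈ I) (ha : a ∈ nonZeroDivisors R) :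
    ∃ e, (F.map (Ideal.Quotient.mk (Ideal.span {a}))).IsHilbertCoeff 1 e ∧
      (e 0 = 0 → F.IsAdicModulo e a) := by
  have := hCM.1
  let π := Ideal.Quotient.mk (Ideal.span {a})
  have hπ : Function.Surjective π := Ideal.Quotient.mk_surjective
  have := isLocalRing_quotient_span_singleton (hI.le_maximalIdeal haI)
  have := infinite_residueField_quotient (Ideal.span {a})
  have hd' : ringKrullDim (R ⧸ Ideal.span {a}) ≤ 1 := by
    rw [← ENat.WithBot.add_le_add_one_right_iff]
    exact (ringKrullDim_quotient_succ_le_of_nonZeroDivisor ha).trans hd.le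
  have h0 := (hCM.depthPos_span_singleton hd ha).quotient
  have hFπ := hF.map hπ
  have hIπ := hI.map hπ
  have hJπ := hJ.map hπ
  obtain ⟨e, he⟩ := hFπ.exists_isHilbertCoeff_one hd' h0 hIπ hJπ
  refine ⟨e, he, fun he0 => ⟨?_, ?_, fun r s => ?_, fun r s => ?_⟩⟩
  · obtain ⟨x, hx⟩ := hFπ.exists_eq_span_left hd' h0 hIπ hJπ he he0
    exact exists_le_span_sup_of_map_eq_span hx
  · obtain ⟨y, hy⟩ := hFπ.exists_eq_span_right hd' h0 hIπ hJπ he he0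
    exact exists_le_span_sup_of_map_eq_span hy
  · have h : (F.ideal r s).map π = (I ^ r * J ^ s).map π := by
      rw [Ideal.map_mul, Ideal.map_pow, Ideal.map_pow]
      exact hFπ.ideal_eq_of_dim_one hd' h0 hIπ hJπ he he0 r s
    simpa only [π, Ideal.comap_map_quotientMk, sup_comm] using congrArg (Ideal.comap π) h
  · rw [← colength_map_quotient]
    exact hFπ.hilbertFunction_eq_binomialPolynomial_one hd' h0 hIπ hJπ he he0
      (Int.natCast_nonneg r) (Int.natCast_nonneg s)

lemma generic_exists_hasBinomialCoeff_sub_left : Generic I fun a => a ∈ nonZeroDivisors R ∧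
    ∃ e, HasBinomialCoeff (fun r s => F.hilbertFunction r s - F.hilbertFunction (r - 1) s) 1 e ∧
      (e 0 = 0 → F.IsAdicModulo e a) := by
  refine (hF.generic_hilbertFunction_sub_eq hCM hd hI hJ).mono fun a haI ⟨ha, N, hN⟩ => ⟨ha, ?_⟩
  obtain ⟨e, ⟨he, N', hN'⟩, hadic⟩ := hF.exists_isHilbertCoeff_map_quotient hCM hd hI hJ haI ha
  refine ⟨e, ⟨he, max N N', fun r s hr hs => ?_⟩, hadic⟩
  exact (hN r s (by omega)).trans (hN' r s (by omega) (by omega))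

lemma exists_isHilbertCoeff_two : ∃ e, F.IsHilbertCoeff 2 e := by
  obtain ⟨_, _, _, _, hl, _⟩ :=
    (hF.generic_exists_hasBinomialCoeff_sub_left hCM hd hI hJ).exists
  obtain ⟨_, _, _, _, hr, _⟩ :=
    (hF.swap.generic_exists_hasBinomialCoeff_sub_left hCM hd hJ hI).exists
  exact HasBinomialCoeff.exists_succ hl hr.swap

variable (he : F.IsHilbertCoeff 2 e) (h10 : e (1, 0) = 0)
include he h10

lemma generic_isAdicModulo : Generic I fun a => a ∈ nonZeroDivisors R ∧
    F.IsAdicModulo (fun α => e (α.1 + 1, α.2)) a := by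
  refine (hF.generic_exists_hasBinomialCoeff_sub_left hCM hd hI hJ).mono
    fun a _ ⟨ha, e', he', hadic⟩ => ⟨ha, ?_⟩
  obtain rfl := he'.unique (HasBinomialCoeff.sub_left he)
  exact hadic h10

variable (h01 : e (0, 1) = 0)
include h01

lemma exists_lists_inGeneralPosition (r s : ℕ) : ∃ as bs : List R, as.length = r ∧ bs.length = s ∧
    (∀ a ∈ as, F.IsAdicModulo (fun α => e (α.1 + 1, α.2)) a) ∧
    (∀ b ∈ bs, F.swap.IsAdicModulo (fun α => e (α.2, α.1 + 1)) b) ∧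
    InGeneralPosition I as bs ∧ InGeneralPosition J bs [] := by
  have := hCM.1
  obtain ⟨bs, hbs, hbJ, hb⟩ := exists_inGeneralPosition
    (hF.swap.generic_isAdicModulo hCM hd hJ hI (HasBinomialCoeff.swap he) h01)
    (fun c hc hp => generic_regularPair hJ.containsMaxPow (hJ.le_maximalIdeal hc)
      (hCM.depthPos_span_singleton hd hp.1) hp.2.exists_left) (cs := []) (by simp) s
  obtain ⟨as, has, haI, ha⟩ := exists_inGeneralPosition
    (hF.generic_isAdicModulo hCM hd hI hJ he h10)
    (fun c hc hp => generic_regularPair hI.containsMaxPow (hI.le_maximalIdeal hc)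
      (hCM.depthPos_span_singleton hd hp.1) hp.2.exists_left) (cs := bs)
    (fun b hb => generic_regularPair hI.containsMaxPow (hJ.le_maximalIdeal (hbJ b hb).1)
      (hCM.depthPos_span_singleton hd (hbJ b hb).2.1) (hbJ b hb).2.2.exists_right) r
  exact ⟨as, bs, has, hbs, fun a ha => (haI a ha).2.2, fun b hb => (hbJ b hb).2.2, ha, hb⟩

lemma ideal_eq_pow_mul_pow (r s : ℕ) : F.ideal r s = I ^ r * J ^ s := by
  obtain ⟨as, bs, rfl, rfl, has, hbs, ha, hb⟩ :=
    hF.exists_lists_inGeneralPosition hCM hd hI hJ he h10 h01 r s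
  refine le_antisymm (fun f hf => ha.mem_pow_mul (fun g hg => hb.mem_pow hg) ?_)
    (by simpa [idealZPow] using F.pow_le as.length bs.length)
  refine List.forall_mem_append.mpr ⟨fun a ha => ?_, fun b hb => ?_⟩
  · exact (has a ha).ideal_sup_eq _ _ ▸ Ideal.mem_sup_left hf
  · rw [mul_comm, ← (hbs b hb).ideal_sup_eq]
    exact Ideal.mem_sup_left hf

lemma hilbertFunction_sub_eq_binomialPolynomial {r s : ℤ} (hr : 0 ≤ r) (hs : 0 ≤ s) :
    F.hilbertFunction (r + 1) s - F.hilbertFunction r s =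
      binomialPolynomial 2 e (r + 1) s - binomialPolynomial 2 e r s := by
  have := hCM.1
  lift r to ℕ using hr
  lift s to ℕ using hs
  obtain ⟨as, bs, hlen, rfl, has, -, ha, hb⟩ :=
    hF.exists_lists_inGeneralPosition hCM hd hI hJ he h10 h01 (r + 1) s
  obtain ⟨a, as, rfl⟩ := List.exists_cons_of_length_eq_add_one hlen
  obtain rfl : as.length = r := by simpa using hlen
  have hideal := hF.ideal_eq_pow_mul_pow hCM hd hI hJ he h10 h01
  have hcolon : (F.ideal (as.length + 1 : ℕ) bs.length).colon {a} =
      F.ideal as.length bs.length := by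
    rw [hideal, hideal]
    exact ha.colon_pow_mul fun g hg => hb.mem_pow hg
  have hP := binomialPolynomial_sub_left 1 e (as.length + 1 : ℕ) bs.length
  rw [← (has a (by simp)).colength_eq, Nat.cast_succ, add_sub_cancel_right] at hP
  have hH := (F.containsMaxPow hI hJ (as.length + 1 : ℕ) bs.length).colength_eq_add a
  rw [hcolon] at hH
  rw [hP, sub_eq_iff_eq_add']
  exact hH

lemma hilbertFunction_eq_binomialPolynomial_two {r s : ℤ} (hr : 0 ≤ r) (hs : 0 ≤ s) :
    F.hilbertFunction r s = binomialPolynomial 2 e r s := by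
  let D (r s : ℤ) : ℤ := F.hilbertFunction r s - binomialPolynomial 2 e r s
  have hD {r s : ℤ} (hr : 0 ≤ r) (hs : 0 ≤ s) : D r s = D 0 0 := by
    refine eq_of_differences_eq_zero (fun r s hr hs => ?_) (fun r s hr hs => ?_) hr hs
    · have := hF.hilbertFunction_sub_eq_binomialPolynomial hCM hd hI hJ he h10 h01 hr hs
      linarith
    · have : F.hilbertFunction r (s + 1) - F.hilbertFunction r s = _ :=
        hF.swap.hilbertFunction_sub_eq_binomialPolynomial hCM hd hJ hI (HasBinomialCoeff.swap he)
          h01 h10 hs hr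
      simp only [binomialPolynomial_swap] at this
      linarith
  obtain ⟨N, hN⟩ := he.2
  have hfar : D (max 0 N) (max 0 N) = 0 :=
    sub_eq_zero.mpr (hN _ _ (le_max_right _ _) (le_max_right _ _))
  rw [hD (le_max_left _ _) (le_max_left _ _)] at hfar
  exact sub_eq_zero.mp ((hD hr hs).trans hfar)

end Filtration.IsAdmissible

end DimensionTwo

section ParameterIdeal

variable {R : Type*} [CommRing R] [IsLocalRing R] {I J : Ideal R} {F : Filtration I J} {a x : R}

lemma isParameterIdeal_span_singleton (hd : ringKrullDim R = ((1 : ℕ∞) : WithBot ℕ∞))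
    (hI : IsMaximalPrimary I) (h : I = Ideal.span {a}) : IsParameterIdeal I := by
  have hspan : I = Ideal.span (Set.range ![a]) := by simpa using h
  exact ⟨1, ![a], ⟨hd, hspan ▸ hI⟩, hspan⟩

lemma isParameterIdeal_of_le_sup (hd : ringKrullDim R = ((2 : ℕ∞) : WithBot ℕ∞))
    (hI : IsMaximalPrimary I) (ha : a ∈ I) (hx : x ∈ I)
    (h : I ≤ Ideal.span {x} ⊔ Ideal.span {a}) : IsParameterIdeal I := by
  have hspan : I = Ideal.span (Set.range ![x, a]) := by
    rw [Matrix.range_cons, Matrix.range_cons, Matrix.range_empty, Set.union_empty,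
      Ideal.span_union]
    exact le_antisymm h (sup_le ((Ideal.span_singleton_le_iff_mem I).mpr hx)
      ((Ideal.span_singleton_le_iff_mem I).mpr ha))
  exact ⟨2, ![x, a], ⟨hd, hspan ▸ hI⟩, hspan⟩

lemma IsParameterIdeal.exists_eq_sup (h : IsParameterIdeal I)
    (hd : ringKrullDim R = ((2 : ℕ∞) : WithBot ℕ∞)) :
    ∃ x y, I = Ideal.span {x} ⊔ Ideal.span {y} := by
  obtain ⟨d, x, ⟨hd', -⟩, rfl⟩ := h
  obtain rfl : 2 = d := by exact_mod_cast WithBot.coe_injective (hd.symm.trans hd')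
  refine ⟨x 0, x 1, ?_⟩
  rw [← Ideal.span_union]
  congr 1
  ext z
  simp [Fin.exists_fin_two, eq_comm, or_comm]

lemma exists_le_span_sup_of_notMem {x y : R} (hI : I = Ideal.span {x} ⊔ Ideal.span {y})
    (ha : a ∈ I) (ham : a ∉ maximalIdeal R * I) :
    ∃ z ∈ I, I ≤ Ideal.span {z} ⊔ Ideal.span {a} := by
  have hx : x ∈ I := hI ▸ Ideal.mem_sup_left (Ideal.mem_span_singleton_self x)
  have hy : y ∈ I := hI ▸ Ideal.mem_sup_right (Ideal.mem_span_singleton_self y)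
  obtain ⟨u, _, hv, rfl⟩ := Ideal.mem_span_singleton_sup.mp (hI ▸ ha)
  obtain ⟨v, rfl⟩ := Ideal.mem_span_singleton'.mp hv
  obtain hu | hv : IsUnit u ∨ IsUnit v := by
    contrapose! ham
    exact Ideal.add_mem _ (Ideal.mul_mem_mul ham.1 hx) (Ideal.mul_mem_mul ham.2 hy)
  · exact ⟨y, hy, (le_span_singleton_sup_of_isUnit hI.le hu hv).trans_eq (sup_comm _ _)⟩
  · refine ⟨x, hx, ?_⟩
    rw [sup_comm, add_comm]
    exact le_span_singleton_sup_of_isUnit (hI.trans (sup_comm _ _)).le hv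
      (Ideal.mul_mem_left _ u (Ideal.mem_span_singleton_self x))

variable [IsNoetherianRing R]

lemma RegularPair.colength_pow_sup (h : RegularPair I x a) (hI : ContainsMaxPow I) (hx : x ∈ I)
    (ha : a ∈ I) (n : ℕ) : colength (I ^ n ⊔ Ideal.span {a}) = n * colength I := by
  induction n with
  | zero => simp [colength_top]
  | succ n ih =>
    have hcolon : (I ^ (n + 1) ⊔ Ideal.span {a}).colon {x} = I ^ n ⊔ Ideal.span {a} := by
      ext z
      rw [Submodule.mem_colon_singleton, smul_eq_mul, mul_comm, pow_succ']
      refine ⟨h.mem_of_mul_mem, fun hz => ?_⟩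
      have hxz := Ideal.mul_mem_mul hx hz
      rw [Ideal.mul_sup] at hxz
      exact SetLike.le_def.mp (sup_le_sup_left Ideal.mul_le_right _) hxz
    have hsup : I ^ (n + 1) ⊔ Ideal.span {a} ⊔ Ideal.span {x} = I := by
      refine le_antisymm (sup_le (sup_le (Ideal.pow_le_self n.succ_ne_zero) ?_) ?_)
        (h.le_sup.trans (sup_le le_sup_right (le_sup_right.trans le_sup_left)))
      · rwa [Ideal.span_singleton_le_iff_mem]
      · rwa [Ideal.span_singleton_le_iff_mem]
    rw [((hI.pow (n + 1)).mono le_sup_left).colength_eq_add x, hcolon, hsup, ih]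
    push_cast
    ring

lemma Filtration.IsAdmissible.coeff_one_zero_eq_zero [Infinite (ResidueField R)]
    (hF : F.IsAdmissible) (hCM : IsCohenMacaulayLocal R)
    (hd : ringKrullDim R = ((2 : ℕ∞) : WithBot ℕ∞)) (hI : IsMaximalPrimary I)
    (hJ : IsMaximalPrimary J) (hpar : IsParameterIdeal I) {e : ℕ × ℕ → ℤ}
    (hP : ∀ r : ℕ, binomialPolynomial 2 e r 0 = F.hilbertFunction r 0)
    (hpow : ∀ r : ℕ, F.ideal r 0 = I ^ r) : e (1, 0) = 0 := by
  have hnot : ¬ I ≤ maximalIdeal R * I := by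
    have h0 := hCM.depthPos_bot (d := 2) hd one_le_two
    simpa only [bot_sup_eq] using h0.not_le_sup_maximalIdeal_mul bot_ne_top hI.containsMaxPow
  obtain ⟨a, haI, ⟨ha, N, hN⟩, ham⟩ :=
    ((hF.generic_hilbertFunction_sub_eq hCM hd hI hJ).and (generic_notMem hnot)).exists
  obtain ⟨x, y, hxy⟩ := hpar.exists_eq_sup hd
  obtain ⟨z, hzI, hz⟩ := exists_le_span_sup_of_notMem hxy haI ham
  have hreg : RegularPair I z a := ⟨hz, fun w hw =>
    (hCM.depthPos_span_singleton hd ha).mem_of_mul_mem (hI.containsMaxPow.mono hz) hw⟩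
  have hdiff (r : ℕ) (hr : N ≤ r) :
      (r + 1) * e (2, 0) - e (1, 0) = (r + 1) * colength I := by
    have hH := hN (r + 1 : ℕ) 0 (by omega)
    change _ = colength ((F.ideal (r + 1 : ℕ) 0).map _) at hH
    have hPdiff := binomialPolynomial_sub_left 1 e (r + 1 : ℕ) 0
    rw [colength_map_quotient, hpow,
      hreg.colength_pow_sup hI.containsMaxPow hzI haI, ← hP] at hH
    rw [binomialPolynomial_one] at hPdiff
    rw [Nat.cast_succ, add_sub_cancel_right] at hH hPdiff
    rw [← hP] at hH
    linarith
  have h₀ := hdiff N.toNat (by omega)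
  have h₁ := hdiff (N.toNat + 1) (by omega)
  rw [Nat.cast_succ] at h₁
  have : e (2, 0) = colength I := by linarith
  rw [this] at h₀
  linarith

end ParameterIdeal

section Equivalence

variable {R : Type*} [CommRing R] {I J : Ideal R} {F : Filtration I J}

lemma Filtration.hilbertCoeff_zero_eq_zero {d : ℕ}
    (h : F.hilbertPolynomial d 0 0 = F.hilbertFunction 0 0) : F.hilbertCoeff d 0 = 0 := by
  rw [Filtration.hilbertPolynomial, binomialPolynomial_zero_zero, hilbertFunction_zero_zero] at h
  simpa using h

variable [IsLocalRing R] [Infinite (ResidueField R)]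

theorem Filtration.IsAdmissible.tfae_of_dim_one (hF : F.IsAdmissible)
    (hCM : IsCohenMacaulayLocal R) (hd : ringKrullDim R = ((1 : ℕ∞) : WithBot ℕ∞))
    (hI : IsMaximalPrimary I) (hJ : IsMaximalPrimary J) :
    List.TFAE [
      F.hilbertCoeff 1 0 = 0,
      IsParameterIdeal I ∧ IsParameterIdeal J ∧
        (∀ r s : ℕ, F.hilbertPolynomial 1 r s = F.hilbertFunction r s) ∧
        (∀ r s : ℤ, F.ideal r s = idealZPow I r * idealZPow J s),
      ∀ α : ℕ × ℕ, α.1 + α.2 ≤ 0 → F.hilbertCoeff 1 α = 0] := by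
  have := hCM.1
  have h0 := hCM.depthPos_bot (d := 1) hd le_rfl
  have he := F.isHilbertCoeff_hilbertCoeff (hF.exists_isHilbertCoeff_one hd.le h0 hI hJ)
  tfae_have 3 → 1 := fun h => h 0 le_rfl
  tfae_have 1 → 2 := by
    intro he0
    obtain ⟨a, ha⟩ := hF.exists_eq_span_left hd.le h0 hI hJ he he0
    obtain ⟨b, hb⟩ := hF.exists_eq_span_right hd.le h0 hI hJ he he0
    exact ⟨isParameterIdeal_span_singleton hd hI ha, isParameterIdeal_span_singleton hd hJ hb,
      fun r s => (hF.hilbertFunction_eq_binomialPolynomial_one hd.le h0 hI hJ he he0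
        (Int.natCast_nonneg r) (Int.natCast_nonneg s)).symm,
      hF.ideal_eq_idealZPow_of_nat (hF.ideal_eq_of_dim_one hd.le h0 hI hJ he he0 · ·)⟩
  tfae_have 2 → 3 := by
    rintro ⟨-, -, hP, -⟩ ⟨i, j⟩ hα
    obtain ⟨rfl, rfl⟩ : i = 0 ∧ j = 0 := by simpa using hα
    exact F.hilbertCoeff_zero_eq_zero (hP 0 0)
  tfae_finish

theorem Filtration.IsAdmissible.tfae_of_dim_two (hF : F.IsAdmissible)
    (hCM : IsCohenMacaulayLocal R) (hd : ringKrullDim R = ((2 : ℕ∞) : WithBot ℕ∞))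
    (hI : IsMaximalPrimary I) (hJ : IsMaximalPrimary J) :
    List.TFAE [
      F.hilbertCoeff 2 (1, 0) = 0 ∧ F.hilbertCoeff 2 (0, 1) = 0,
      IsParameterIdeal I ∧ IsParameterIdeal J ∧
        (∀ r s : ℕ, F.hilbertPolynomial 2 r s = F.hilbertFunction r s) ∧
        (∀ r s : ℤ, F.ideal r s = idealZPow I r * idealZPow J s),
      ∀ α : ℕ × ℕ, α.1 + α.2 ≤ 1 → F.hilbertCoeff 2 α = 0] := by
  have := hCM.1
  have he := F.isHilbertCoeff_hilbertCoeff (hF.exists_isHilbertCoeff_two hCM hd hI hJ)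
  tfae_have 3 → 1 := fun h => ⟨h (1, 0) le_rfl, h (0, 1) le_rfl⟩
  tfae_have 1 → 2 := by
    rintro ⟨h10, h01⟩
    obtain ⟨a, haI, -, ha⟩ := (hF.generic_isAdicModulo hCM hd hI hJ he h10).exists
    obtain ⟨b, hbJ, -, hb⟩ :=
      (hF.swap.generic_isAdicModulo hCM hd hJ hI (HasBinomialCoeff.swap he) h01).exists
    obtain ⟨x, hxI, hx⟩ := ha.exists_left
    obtain ⟨y, hyJ, hy⟩ := hb.exists_left
    exact ⟨isParameterIdeal_of_le_sup hd hI haI hxI hx, isParameterIdeal_of_le_sup hd hJ hbJ hyJ hy,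
      fun r s => (hF.hilbertFunction_eq_binomialPolynomial_two hCM hd hI hJ he h10 h01
        (Int.natCast_nonneg r) (Int.natCast_nonneg s)).symm,
      hF.ideal_eq_idealZPow_of_nat (hF.ideal_eq_pow_mul_pow hCM hd hI hJ he h10 h01)⟩
  tfae_have 2 → 3 := by
    rintro ⟨hIpar, hJpar, hP, hpow⟩ ⟨i, j⟩ hα
    have h00 := F.hilbertCoeff_zero_eq_zero (hP 0 0)
    have h10 := hF.coeff_one_zero_eq_zero hCM hd hI hJ hIpar (hP · 0)
      fun r => by simp [hpow, idealZPow]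
    have h01 := hF.swap.coeff_one_zero_eq_zero hCM hd hJ hI hJpar
      (e := fun α => F.hilbertCoeff 2 α.swap)
      (fun s => (binomialPolynomial_swap 2 _ 0 s).trans (hP 0 s))
      fun s => (hpow 0 s).trans (by simp [idealZPow])
    obtain ⟨rfl, rfl⟩ | ⟨rfl, rfl⟩ | ⟨rfl, rfl⟩ :
        (i = 0 ∧ j = 0) ∨ (i = 1 ∧ j = 0) ∨ (i = 0 ∧ j = 1) := by dsimp only at hα; omega
    exacts [h00, h10, h01]
  tfae_finish

end Equivalence

end BigradedHilbert

theorem theorem4p6 {R : Type*} [CommRing R] [IsLocalRing R]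
    [Infinite (IsLocalRing.ResidueField R)]
    (hCM : BigradedHilbert.IsCohenMacaulayLocal R)
    (d : ℕ) (hd : ringKrullDim R = ((d : ℕ∞) : WithBot ℕ∞)) (hd1 : 1 ≤ d) (hd2 : d ≤ 2)
    (I J : Ideal R) (hI : BigradedHilbert.IsMaximalPrimary I)
    (hJ : BigradedHilbert.IsMaximalPrimary J)
    (F : BigradedHilbert.Filtration I J) (hF : F.IsAdmissible) :
    List.TFAE [
      F.hilbertCoeff d (d - 1, 0) = 0 ∧ F.hilbertCoeff d (0, d - 1) = 0,
      BigradedHilbert.IsParameterIdeal I ∧ BigradedHilbert.IsParameterIdeal J ∧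
        (∀ r s : ℕ, F.hilbertPolynomial d r s = F.hilbertFunction r s) ∧
        (∀ r s : ℤ, F.ideal r s =
          BigradedHilbert.idealZPow I r * BigradedHilbert.idealZPow J s),
      ∀ α : ℕ × ℕ, α.1 + α.2 ≤ d - 1 → F.hilbertCoeff d α = 0] := by
  obtain rfl | rfl : d = 1 ∨ d = 2 := by omega
  · simpa only [tsub_self, and_self, Prod.mk_zero_zero] using hF.tfae_of_dim_one hCM hd hI hJ
  · exact hF.tfae_of_dim_two hCM hd hI hJ
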